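/- Let $1\le a<m$ be integers. For $\alpha_1,\dots,\alpha_m>0$ write $Q(u)=\prod_{j=1}^a(\alpha_j+u)\prod_{j=a+1}^m(\alpha_j-u)$, and consider differentiable functions $u,\theta_1,\dots,\theta_m:\mathbb R\to\mathbb R$, with $\theta=\theta_1+\cdots+\theta_m$, such that for all $t$ one has $\alpha_j+u>0$ for $j\le a$, $\alpha_j-u>0$ for $j>a$, and $$\frac{du}{dt}=2Q(u)^{1/2}\cos\theta,\qquad \frac{d\theta_j}{dt}=-\frac{Q(u)^{1/2}\sin\theta}{\alpha_j+u}\ (j\le a),\qquad \frac{d\theta_j}{dt}=\frac{Q(u)^{1/2}\sin\theta}{\alpha_j-u}\ (j>a),$$ and $Q(u(0))^{1/2}\sin\theta(0)=A$ (the quantity $Q(u)^{1/2}\sin\theta$ is constant along solutions). Let $$U=\Bigl\{(\alpha_1,\dots,\alpha_m,A)\in\mathbb R^{m+1}:\alpha_j>0,\ \sum_{j=1}^a\frac1{\alpha_j}=\sum_{j=a+1}^m\frac1{\alpha_j},\ 0<A<(\alpha_1\cdots\alpha_m)^{1/2}\Bigr\},$$ $$V=\{x\in(-\infty,0)^a\times(0,\infty)^{m-a}:x_1+\cdots+x_m=0\},\qquad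 H=\{x\in\mathbb R^m:x_1+\cdots+x_m=0\}.$$ For each $(\alpha_1,\dots,\alpha_m,A)\in U$ such solutions exist, and there are unique real numbers $\beta_1,\dots,\beta_m$, depending only on $(\alpha_1,\dots,\alpha_m,A)$, such that for every such solution $u$ and $\theta$ have a least positive common period $T$, and $\theta_j(t+T)=\theta_j(t)+\beta_j$ for all $t\in\mathbb R$ and all $j$. Regard $\boldsymbol\beta=(\beta_1,\dots,\beta_m)$ as a function on $U$. Then: * $\boldsymbol\beta$ is a real analytic map from the real analytic hypersurface $U\subset\mathbb R^{m+1}$ to $V$. * If $m=2$, then $\boldsymbol\beta(p)=(-\pi,\pi)$ for all $p\in U$. * If $m\ge3$, then the image $\boldsymbol\beta(U)$ is $(m-1)$-dimensional: it contains a nonempty relatively open subset of $H$, and its Hausdorff dimension is $m-1$. * If $m\ge3$, then there is a dense, relatively open subset of $U$ at every point $p$ of which the derivative $d\boldsymbol\beta|_p:T_pU\to H$ is surjective, where $T_pU\subset\mathbb R^{m+1}$ is the tangent space of $U$ at $p$. -/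

import Mathlib

noncomputable section

namespace PeriodShift

/-- The sign attached to the `j`-th coordinate: `+1` for the first `a` coordinates
(indices `0, …, a - 1` of `Fin m`) and `-1` for the remaining `m - a`. -/
def sgn (a : ℕ) {m : ℕ} (j : Fin m) : ℝ := if (j : ℕ) < a then 1 else -1

/-- `Q(u) = ∏_{j ≤ a} (α_j + u) ∏_{j > a} (α_j - u)`. -/
def Q (a : ℕ) {m : ℕ} (α : Fin m → ℝ) (u : ℝ) : ℝ := ∏ j, (α j + sgn a j * u)

/-- `u, θ_1, …, θ_m : ℝ → ℝ` solve, for all times, the system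
`u' = 2 Q(u)^{1/2} cos θ`, `θ_j' = -Q(u)^{1/2} sin θ / (α_j + u)` for `j ≤ a`,
`θ_j' = Q(u)^{1/2} sin θ / (α_j - u)` for `j > a`, where `θ = θ_1 + ⋯ + θ_m`; moreover
`α_j + u > 0` for `j ≤ a`, `α_j - u > 0` for `j > a`, and the value at time `0` of the
conserved quantity `Q(u)^{1/2} sin θ` is `A`. -/
structure IsSolution (a : ℕ) {m : ℕ} (α : Fin m → ℝ) (A : ℝ)
    (u : ℝ → ℝ) (θ : Fin m → ℝ → ℝ) : Prop where
  pos : ∀ t j, 0 < α j + sgn a j * u t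
  hasDerivAt_u : ∀ t, HasDerivAt u (2 * √(Q a α (u t)) * Real.cos (∑ i, θ i t)) t
  hasDerivAt_θ : ∀ j t, HasDerivAt (θ j)
    (-sgn a j * (√(Q a α (u t)) * Real.sin (∑ i, θ i t) / (α j + sgn a j * u t))) t
  amplitude : √(Q a α (u 0)) * Real.sin (∑ i, θ i 0) = A

/-- `T` is the least positive common period of `u` and `θ = θ_1 + ⋯ + θ_m`. -/
def IsPeriod {m : ℕ} (u : ℝ → ℝ) (θ : Fin m → ℝ → ℝ) (T : ℝ) : Prop :=
  IsLeast {T : ℝ | 0 < T ∧ Function.Periodic u T ∧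
    Function.Periodic (fun t => ∑ i, θ i t) T} T

/-- `b = (b_1, …, b_m)` is the period shift at `(α, A)`: solutions with these parameters exist,
and every one of them has a period `T` with `θ_j(t + T) = θ_j(t) + b_j` for all `j` and `t`. -/
def IsShift (a : ℕ) {m : ℕ} (p : (Fin m → ℝ) × ℝ) (b : Fin m → ℝ) : Prop :=
  (∃ u θ, IsSolution a p.1 p.2 u θ) ∧
  ∀ u θ, IsSolution a p.1 p.2 u θ →
    ∃ T, IsPeriod u θ T ∧ ∀ j t, θ j (t + T) = θ j t + b j

/-- A period shift, where it exists, is unique. -/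
theorem IsShift.unique {a m : ℕ} {p : (Fin m → ℝ) × ℝ} {b c : Fin m → ℝ}
    (hb : IsShift a p b) (hc : IsShift a p c) : b = c := by
  obtain ⟨⟨u, θ, h⟩, hb⟩ := hb
  obtain ⟨T, hT, hTb⟩ := hb u θ h
  obtain ⟨S, hS, hSc⟩ := hc.2 u θ h
  have hTS : T = S := IsLeast.unique hT hS
  subst hTS
  funext j
  have h1 := hTb j 0
  have h2 := hSc j 0
  linarith

open Classical in
/-- The period-shift map `β = (β_1, …, β_m)` as a function of `(α_1, …, α_m, A)`
(with the value `0` where there is no period shift). -/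
def shift (a m : ℕ) (p : (Fin m → ℝ) × ℝ) : Fin m → ℝ :=
  if h : ∃ b, IsShift a p b then h.choose else 0

/-- The function `∑_{j ≤ a} 1/α_j - ∑_{j > a} 1/α_j` of `(α_1, …, α_m, A)`. -/
def balance (a : ℕ) {m : ℕ} (p : (Fin m → ℝ) × ℝ) : ℝ :=
  ∑ j ∈ Finset.univ.filter (fun j : Fin m => (j : ℕ) < a), 1 / p.1 j -
    ∑ j ∈ Finset.univ.filter (fun j : Fin m => a ≤ (j : ℕ)), 1 / p.1 j

/-- The parameter space `U`. -/
def U (a m : ℕ) : Set ((Fin m → ℝ) × ℝ) :=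
  {p | (∀ j, 0 < p.1 j) ∧
    ∑ j ∈ Finset.univ.filter (fun j : Fin m => (j : ℕ) < a), 1 / p.1 j =
      ∑ j ∈ Finset.univ.filter (fun j : Fin m => a ≤ (j : ℕ)), 1 / p.1 j ∧
    0 < p.2 ∧ p.2 < √(∏ j, p.1 j)}

/-- The target `V`. -/
def V (a m : ℕ) : Set (Fin m → ℝ) :=
  {x | (∀ j : Fin m, (j : ℕ) < a → x j < 0) ∧ (∀ j : Fin m, a ≤ (j : ℕ) → 0 < x j) ∧
    ∑ j, x j = 0}

/-- The hyperplane `{x ∈ ℝ^m : x_1 + ⋯ + x_m = 0}`. -/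
def hyperplane (m : ℕ) : Submodule ℝ (Fin m → ℝ) where
  carrier := {x | ∑ j, x j = 0}
  add_mem' := by
    intro x y hx hy
    change ∑ j, (x j + y j) = 0
    have hx' : ∑ j, x j = 0 := hx
    have hy' : ∑ j, y j = 0 := hy
    rw [Finset.sum_add_distrib, hx', hy', add_zero]
  zero_mem' := by simp
  smul_mem' := by
    intro c x hx
    change ∑ j, c * x j = 0
    have hx' : ∑ j, x j = 0 := hx
    rw [← Finset.mul_sum, hx', mul_zero]

/-- The tangent space at `p` of the hypersurface `U ⊆ ℝ^{m+1}`: the kernel of the differential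
of its defining equation. -/
def tangentSpace (a m : ℕ) (p : (Fin m → ℝ) × ℝ) : Submodule ℝ ((Fin m → ℝ) × ℝ) :=
  LinearMap.ker (fderiv ℝ (balance a) p : (Fin m → ℝ) × ℝ →ₗ[ℝ] ℝ)

/-- A map `f`, defined on the hypersurface `U`, is differentiable at `p` along `U`, and its
derivative maps the tangent space of `U` at `p` onto the hyperplane `x_1 + ⋯ + x_m = 0`.
(`HasFDerivWithinAt f L U p` pins down `L` on the tangent space.) -/
def DerivSurjectiveAt (a m : ℕ) (f : (Fin m → ℝ) × ℝ → (Fin m → ℝ)) (p : (Fin m → ℝ) × ℝ) :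
    Prop :=
  ∃ L : (Fin m → ℝ) × ℝ →L[ℝ] (Fin m → ℝ), HasFDerivWithinAt f L (U a m) p ∧
    (tangentSpace a m p).map (L : (Fin m → ℝ) × ℝ →ₗ[ℝ] (Fin m → ℝ)) = hyperplane m

end PeriodShift

end

open Set Filter Topology MeasureTheory

namespace PeriodShift

/-! Put y_j = 1/α_j for j ≤ a and y_j = -1/α_j for j > a. The balance condition reads Σ y_j = 0, and
Q(u) = κ² ∏ (1 + y_j u) with κ² = α_1 ⋯ α_m. The product has no linear term, and u = 0 is its only
critical point on the admissible interval, a nondegenerate maximum. Hence a global Morse coordinate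
x = `morse y u` turns Q into κ²(1 - x²), and its inverse `invMorse` is analytic jointly in (y, x).

With w = Q^{1/2} cos θ / κ the flow becomes x' = k w, w' = -k x with k > 0: a rotation of variable
speed on the circle x² + w² = c², where c² = 1 - A²/κ². One period is one turn, and β_j is the
integral over s ∈ [0, 2π] of a density evaluated at x = c sin s (`Params.isShift`). This formula is
analytic for all y ≠ 0 and |c| < 1, in particular across c = 0, the equilibrium limit that lies
outside U.

For m = 2 the Morse coordinate is linear in u and the integral is elementary. For m ≥ 3, (y, c)
parametrizes U by an open convex subset of H × (0, 1), and everything reduces to one point where the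
derivative of `shiftMap` is onto. At c = 0 the map is -√2 π y/|y|, so its y-derivative supplies all
directions orthogonal to y and misses only the radial one. To obtain the radial direction from the
c-derivative, take y with just two values, 1/a and -1/(m - a). Then the shift is exactly -g(c) y,
and g(c) < g(0) for c ≠ 0 (`TwoValued.exists_factor`), by comparing the Morse remainder with a
function whose average is explicit. As g is analytic and not constant, g'(c) ≠ 0 for small c > 0,
while the transversal part stays invertible by continuity (`exists_surjective_fderiv`).

Surjectivity at this point gives an open piece of the image and hence its dimension. A determinant
that is analytic on the convex parameter set and nonzero at the good point cannot vanish on any open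
set, which gives density. -/

/-! ### Analytic dependence of integrals on parameters -/

/-- The integral over a short interval of a jointly analytic function is analytic in the
parameter. -/
theorem analyticAt_integral_of_analyticAt {E F : Type*} [NormedAddCommGroup E] [NormedSpace ℝ E]
    [NormedAddCommGroup F] [NormedSpace ℝ F] [CompleteSpace F] {f : E × ℝ → F} {x₀ : E} {s₀ : ℝ}
    (hf : AnalyticAt ℝ f (x₀, s₀)) :
    ∃ ε > 0, ∀ a ∈ Metric.ball s₀ ε, ∀ b ∈ Metric.ball s₀ ε,
      (∀ᶠ x in 𝓝 x₀, IntervalIntegrable (fun s => f (x, s)) volume a b) ∧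
      AnalyticAt ℝ (fun x => ∫ s in a..b, f (x, s)) x₀ := by
  obtain ⟨p, r, hp⟩ := hf
  -- The double radius leaves room to move the centre by ρ in s and still evaluate within ρ in x.
  obtain ⟨ρ, hρ0, hρ⟩ : ∃ ρ : NNReal, 0 < ρ ∧ ((ρ + ρ : NNReal) : ENNReal) < r := by
    obtain ⟨ρ, h0, h1⟩ := ENNReal.lt_iff_exists_nnreal_btwn.1 hp.r_pos
    refine ⟨ρ / 2, by simpa using h0, by simpa using h1⟩
  have hρ' : ((ρ + ρ : NNReal) : ENNReal) < p.radius := hρ.trans_le hp.r_le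
  have hρ1 : (ρ : ENNReal) < p.radius := lt_of_le_of_lt (by exact_mod_cast le_add_self) hρ'
  refine ⟨ρ, by exact_mod_cast hρ0, fun a ha b hb => ?_⟩
  have hab : ∀ s ∈ uIcc a b, ‖((0 : E), s - s₀)‖₊ ≤ ρ ∧ (‖((0 : E), s - s₀)‖₊ : ENNReal) < ρ := by
    intro s hs
    have h1 : s ∈ Metric.ball s₀ (ρ : ℝ) :=
      (convex_ball s₀ (ρ : ℝ)).ordConnected.uIcc_subset ha hb hs
    have h2 : ‖((0 : E), s - s₀)‖₊ < ρ := by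
      rw [← NNReal.coe_lt_coe]
      simpa [Prod.norm_def, Real.dist_eq] using h1
    exact ⟨h2.le, by exact_mod_cast h2⟩
  -- Bound for the k-th coefficient of the series recentred at (x₀, s). It is taken at the largest
  -- displacement ρ, hence uniform in s, so the recentred series may be integrated term by term.
  set C : ℕ → NNReal := fun k =>
    ∑' s : Σ l : ℕ, { s : Finset (Fin (k + l)) // s.card = l }, ‖p (k + s.1)‖₊ * ρ ^ s.1 with hC
  have hCsum : Summable fun k => C k * ρ ^ k := by
    have := p.changeOriginSeries_summable_aux₁ (r := ρ) (r' := ρ) (by exact_mod_cast hρ')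
    simpa only [hC, ← NNReal.tsum_mul_right] using (NNReal.summable_sigma.1 this).2
  have hCle : ∀ k, ∀ s ∈ uIcc a b, ‖p.changeOrigin ((0 : E), s - s₀) k‖₊ ≤ C k := by
    intro k s hs
    refine (p.nnnorm_changeOrigin_le k ((hab s hs).2.trans hρ1)).trans ?_
    have hsum := p.changeOriginSeries_summable_aux₂ hρ1 k
    refine Summable.tsum_le_tsum (fun t => ?_) ?_ hsum
    · gcongr; exact (hab s hs).1
    · refine NNReal.summable_of_le (fun t => ?_) hsum
      gcongr; exact (hab s hs).1
  let ι : E →L[ℝ] E × ℝ := ContinuousLinearMap.inl ℝ E ℝ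
  have hι : ‖ι‖ ≤ 1 := ContinuousLinearMap.norm_inl_le_one ℝ E ℝ
  let q : (k : ℕ) → ℝ → (E [×k]→L[ℝ] F) := fun k s =>
    (p.changeOrigin ((0 : E), s - s₀) k).compContinuousLinearMap fun _ => ι
  have hqle : ∀ k, ∀ s ∈ uIcc a b, ‖q k s‖ ≤ C k := by
    intro k s hs
    refine (ContinuousMultilinearMap.norm_compContinuousLinearMap_le _ _).trans ?_
    have h1 : ‖p.changeOrigin ((0 : E), s - s₀) k‖ ≤ C k := hCle k s hs
    have h2 : ∏ _i : Fin k, ‖ι‖ ≤ 1 := by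
      simpa using pow_le_one₀ (norm_nonneg _) hι
    calc _ ≤ ‖p.changeOrigin ((0 : E), s - s₀) k‖ * 1 := by gcongr
      _ ≤ C k := by simpa using h1
  have hqc : ∀ k, ContinuousOn (q k) (uIcc a b) := by
    intro k s hs
    have h1 : ContinuousAt (fun x => p.changeOrigin x k) ((0 : E), s - s₀) :=
      ((p.hasFPowerSeriesOnBall_changeOrigin k (lt_of_le_of_lt (zero_le) hρ1)).analyticAt_of_mem
        (mem_eball_zero_iff.2 ((hab s hs).2.trans hρ1))).continuousAt
    have h2 : ContinuousAt (fun s : ℝ => p.changeOrigin ((0 : E), s - s₀) k) s :=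
      ContinuousAt.comp (f := fun s : ℝ => ((0 : E), s - s₀)) h1 (by fun_prop)
    exact ((ContinuousMultilinearMap.compContinuousLinearMapL (F := F)
      (fun _ : Fin k => ι)).continuous.continuousAt.comp h2).continuousWithinAt
  have hqi : ∀ k, IntervalIntegrable (q k) volume a b := fun k => (hqc k).intervalIntegrable
  have hsumf : ∀ v : E, ‖v‖₊ < ρ → ∀ s ∈ uIcc a b,
      HasSum (fun k => q k s fun _ => v) (f (x₀ + v, s)) := by
    intro v hv s hs
    have h1 := hp.changeOrigin (y := ((0 : E), s - s₀))
      (((hab s hs).2.trans_le (by exact_mod_cast le_add_self)).trans hρ)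
    have h2 : (v, (0 : ℝ)) ∈ Metric.eball (0 : E × ℝ)
        (r - ‖((0 : E), s - s₀)‖₊) := by
      rw [mem_eball_zero_iff]
      have h3 : ‖(v, (0 : ℝ))‖ₑ < ρ := by
        have : ‖(v, (0 : ℝ))‖₊ < ρ := by simpa [Prod.nnnorm_def] using hv
        exact_mod_cast this
      refine h3.trans_le ?_
      rw [ENNReal.le_sub_iff_add_le_right (by simp) ?_]
      · refine le_trans ?_ hρ.le
        push_cast
        gcongr
        exact (hab s hs).1
      · exact (((hab s hs).2.trans_le (by exact_mod_cast le_add_self)).trans hρ).le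
    have h4 := h1.hasSum h2
    simpa [q, ι] using h4
  have hbound : ∀ v : E, ‖v‖₊ < ρ → ∀ k, ∀ s ∈ uIcc a b, ‖q k s fun _ => v‖ ≤ (C k * ρ ^ k : NNReal) := by
    intro v hv k s hs
    refine ((q k s).le_opNorm _).trans ?_
    simp only [Finset.prod_const, Finset.card_univ, Fintype.card_fin, NNReal.coe_mul,
      NNReal.coe_pow]
    have : ‖v‖ ≤ ρ := by exact_mod_cast hv.le
    gcongr
    exact hqle k s hs
  have hnhd : Metric.ball x₀ (ρ : ℝ) ∈ 𝓝 x₀ := Metric.ball_mem_nhds _ (by exact_mod_cast hρ0)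
  have hci : ∀ v : E, ‖v‖₊ < ρ → ContinuousOn (fun s => f (x₀ + v, s)) (uIcc a b) := by
    intro v hv
    have h1 : ∀ k, ContinuousOn (fun s => q k s fun _ => v) (uIcc a b) := fun k =>
      ((ContinuousMultilinearMap.apply ℝ (fun _ : Fin k => E) F
        (fun _ => v)).continuous).comp_continuousOn (hqc k)
    refine (continuousOn_tsum h1 (NNReal.summable_coe.2 hCsum)
      (fun k s hs => hbound v hv k s hs)).congr fun s hs => ?_
    exact (hsumf v hv s hs).tsum_eq.symm
  refine ⟨?_, ?_⟩
  · filter_upwards [hnhd] with x hx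
    have := hci (x - x₀) (by
      rw [← NNReal.coe_lt_coe]; simpa [dist_eq_norm] using hx)
    simpa using this.intervalIntegrable
  · refine ⟨fun k => ∫ s in a..b, q k s, ρ, ?_, by exact_mod_cast hρ0, ?_⟩
    · refine FormalMultilinearSeries.le_radius_of_summable_nnnorm _ ?_
      refine NNReal.summable_of_le (f := fun k => (C k * ρ ^ k) * ‖b - a‖₊) (fun k => ?_)
        (hCsum.mul_right _)
      have h1 : ‖∫ s in a..b, q k s‖ ≤ C k * |b - a| :=
        intervalIntegral.norm_integral_le_of_norm_le_const fun s hs =>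
          hqle k s (uIoc_subset_uIcc hs)
      have h2 : ‖∫ s in a..b, q k s‖₊ ≤ C k * ‖b - a‖₊ := by
        rw [← NNReal.coe_le_coe]; simpa using h1
      calc _ ≤ C k * ‖b - a‖₊ * ρ ^ k := by gcongr
        _ = _ := by ring
    · intro v hv
      have hv' : ‖v‖₊ < ρ := by
        rw [mem_eball_zero_iff] at hv
        exact_mod_cast hv
      have h1 := intervalIntegral.hasSum_integral_of_dominated_convergence (μ := volume)
        (a := a) (b := b) (F := fun k s => q k s fun _ => v) (f := fun s => f (x₀ + v, s))
        (fun k _ => ((C k * ρ ^ k : NNReal) : ℝ)) (fun k => ?_) (fun k => ?_) ?_ ?_ ?_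
      · convert h1 using 2 with k
        have h2 := (ContinuousMultilinearMap.apply ℝ (fun _ : Fin k => E) F
          (fun _ => v)).intervalIntegral_comp_comm (hqi k)
        simpa using h2.symm
      · exact ((((ContinuousMultilinearMap.apply ℝ (fun _ : Fin k => E) F
          (fun _ => v)).continuous).comp_continuousOn (hqc k)).mono
            uIoc_subset_uIcc).aestronglyMeasurable measurableSet_uIoc
      · exact .of_forall fun s hs => hbound v hv' k s (uIoc_subset_uIcc hs)
      · exact .of_forall fun s hs => NNReal.summable_coe.2 hCsum
      · exact intervalIntegrable_const
      · exact .of_forall fun s hs => hsumf v hv' s (uIoc_subset_uIcc hs)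

/-- The integral of a jointly analytic function is analytic in the parameter. -/
theorem analyticAt_integral {E F : Type*} [NormedAddCommGroup E] [NormedSpace ℝ E]
    [NormedAddCommGroup F] [NormedSpace ℝ F] [CompleteSpace F] {f : E × ℝ → F} {x₀ : E}
    (hf : ∀ s, AnalyticAt ℝ f (x₀, s)) (a b : ℝ) :
    AnalyticAt ℝ (fun x => ∫ s in a..b, f (x, s)) x₀ := by
  -- The good upper endpoints form a clopen set containing a. Integrability is carried along so that
  -- adjacent intervals can be added.
  let S : Set ℝ := {b | (∀ᶠ x in 𝓝 x₀, IntervalIntegrable (fun s => f (x, s)) volume a b) ∧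
      AnalyticAt ℝ (fun x => ∫ s in a..b, f (x, s)) x₀}
  have key : ∀ s₀, ∃ ε > 0, ∀ c ∈ Metric.ball s₀ ε, ∀ d ∈ Metric.ball s₀ ε, c ∈ S → d ∈ S := by
    intro s₀
    obtain ⟨ε, hε, h⟩ := analyticAt_integral_of_analyticAt (hf s₀)
    refine ⟨ε, hε, fun c hc d hd hcS => ?_⟩
    obtain ⟨h1, h2⟩ := h c hc d hd
    refine ⟨?_, (hcS.2.add h2).congr ?_⟩
    · filter_upwards [h1, hcS.1] with x hx hx' using hx'.trans hx
    · filter_upwards [h1, hcS.1] with x hx hx'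
      simpa using intervalIntegral.integral_add_adjacent_intervals hx' hx
  have hclopen : IsClopen S := by
    refine ⟨⟨?_⟩, ?_⟩
    · rw [Metric.isOpen_iff]
      intro s hs
      obtain ⟨ε, hε, h⟩ := key s
      exact ⟨ε, hε, fun c hc hcS => hs (h c hc s (Metric.mem_ball_self hε) hcS)⟩
    · rw [Metric.isOpen_iff]
      intro s hs
      obtain ⟨ε, hε, h⟩ := key s
      exact ⟨ε, hε, fun c hc => h s (Metric.mem_ball_self hε) c hc hs⟩
  have : S = univ := hclopen.eq_univ ⟨a, by simp, by simpa using analyticAt_const⟩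
  exact (this.symm ▸ mem_univ b : b ∈ S).2

/-! ### The Morse coordinate of the product ∏ (1 + y_j u) -/

section Morse

variable {m : ℕ}

/-- Adding one factor at a time produces R as a polynomial in (y, u), so it is analytic at u = 0
without dividing by u². Balance of y is not needed here, which lets R live on the whole space. -/
theorem exists_quadratic_remainder (m : ℕ) : ∃ R : (Fin m → ℝ) × ℝ → ℝ,
    AnalyticOnNhd ℝ R univ ∧
    (∀ y u, ∏ j, (1 + y j * u) = 1 + (∑ j, y j) * u - u ^ 2 * R (y, u)) ∧
    ∀ y, R (y, 0) = ((∑ j, y j ^ 2) - (∑ j, y j) ^ 2) / 2 := by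
  suffices h : ∀ s : Finset (Fin m), ∃ R : (Fin m → ℝ) × ℝ → ℝ,
      AnalyticOnNhd ℝ R univ ∧
      (∀ y u, ∏ j ∈ s, (1 + y j * u) = 1 + (∑ j ∈ s, y j) * u - u ^ 2 * R (y, u)) ∧
      ∀ y, R (y, 0) = ((∑ j ∈ s, y j ^ 2) - (∑ j ∈ s, y j) ^ 2) / 2 from h Finset.univ
  intro s
  induction s using Finset.induction_on with
  | empty => exact ⟨fun _ => 0, analyticOnNhd_const, by simp, by simp⟩
  | insert i s hi ih =>
    obtain ⟨R, h1, h2, h3⟩ := ih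
    have hc : ∀ j, AnalyticOnNhd ℝ (fun z : (Fin m → ℝ) × ℝ => z.1 j) univ := fun j =>
      ((ContinuousLinearMap.proj (R := ℝ) (φ := fun _ : Fin m => ℝ) j).comp
        (ContinuousLinearMap.fst ℝ (Fin m → ℝ) ℝ)).analyticOnNhd _
    refine ⟨fun z => R z + z.1 i * z.2 * R z - z.1 i * ∑ j ∈ s, z.1 j, ?_, ?_, ?_⟩
    · exact (h1.add (((hc i).mul analyticOnNhd_snd).mul h1)).sub
        ((hc i).mul (Finset.analyticOnNhd_fun_sum _ fun j _ => hc j))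
    · intro y u
      rw [Finset.prod_insert hi, Finset.sum_insert hi, h2]
      ring
    · intro y
      simp only [h3, Finset.sum_insert hi]
      ring

/-- The quadratic Taylor remainder of `u ↦ ∏ (1 + y_j u)` divided by `-u ^ 2`. -/
noncomputable def remainder (z : (Fin m → ℝ) × ℝ) : ℝ := (exists_quadratic_remainder m).choose z

theorem analyticAt_remainder (z : (Fin m → ℝ) × ℝ) : AnalyticAt ℝ (remainder (m := m)) z :=
  (exists_quadratic_remainder m).choose_spec.1 z (mem_univ z)

theorem prod_eq_remainder {y : Fin m → ℝ} (hs : ∑ j, y j = 0) (u : ℝ) :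
    ∏ j, (1 + y j * u) = 1 - u ^ 2 * remainder (y, u) := by
  have := (exists_quadratic_remainder m).choose_spec.2.1 y u
  rw [this, hs]; simp [remainder]

theorem remainder_zero {y : Fin m → ℝ} (hs : ∑ j, y j = 0) :
    remainder (y, 0) = (∑ j, y j ^ 2) / 2 := by
  have := (exists_quadratic_remainder m).choose_spec.2.2 y
  rw [remainder, this, hs]; simp

/-- The interval on which all factors `1 + y_j u` are positive. -/
def dom (y : Fin m → ℝ) : Set ℝ := {u | ∀ j, 0 < 1 + y j * u}

/-- The sum `∑ y_j ^ 2 / (1 + y_j u)`. -/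
noncomputable def curv (y : Fin m → ℝ) (u : ℝ) : ℝ := ∑ j, y j ^ 2 / (1 + y j * u)

/-- The Morse coordinate: `1 - ∏ (1 + y_j u) = morse y u ^ 2`. -/
noncomputable def morse (y : Fin m → ℝ) (u : ℝ) : ℝ := u * √(remainder (y, u))

theorem zero_mem_dom (y : Fin m → ℝ) : (0 : ℝ) ∈ dom y := fun j => by simp

theorem convex_dom (y : Fin m → ℝ) : Convex ℝ (dom y) := by
  intro u hu v hv a b ha hb hab j
  have h1 := hu j
  have h2 := hv j
  simp only [smul_eq_mul]
  have h3 : 1 + y j * (a * u + b * v) = a * (1 + y j * u) + b * (1 + y j * v) := by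
    linear_combination -hab
  rw [h3]
  rcases ha.eq_or_lt with rfl | ha
  · have : b = 1 := by linarith
    subst this; linarith
  · have := mul_pos ha h1
    have := mul_nonneg hb h2.le
    linarith

theorem isOpen_dom_prod : IsOpen {z : (Fin m → ℝ) × ℝ | z.2 ∈ dom z.1} := by
  have : {z : (Fin m → ℝ) × ℝ | z.2 ∈ dom z.1} = ⋂ j, {z | 0 < 1 + z.1 j * z.2} := by
    ext z; simp [dom]
  rw [this]
  exact isOpen_iInter_of_finite fun j => isOpen_lt continuous_const (by fun_prop)

theorem prod_pos_of_mem {y : Fin m → ℝ} {u : ℝ} (hu : u ∈ dom y) : 0 < ∏ j, (1 + y j * u) :=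
  Finset.prod_pos fun j _ => hu j

theorem sum_sq_pos {y : Fin m → ℝ} (hy : y ≠ 0) : 0 < ∑ j, y j ^ 2 := by
  obtain ⟨i, hi⟩ := Function.ne_iff.1 hy
  exact Finset.sum_pos' (fun j _ => sq_nonneg _) ⟨i, Finset.mem_univ i, by
    have : y i ≠ 0 := hi
    positivity⟩

theorem curv_pos {y : Fin m → ℝ} (hy : y ≠ 0) {u : ℝ} (hu : u ∈ dom y) : 0 < curv y u := by
  obtain ⟨i, hi⟩ := Function.ne_iff.1 hy
  refine Finset.sum_pos' (fun j _ => div_nonneg (sq_nonneg _) (hu j).le)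
    ⟨i, Finset.mem_univ i, div_pos ?_ (hu i)⟩
  have : y i ≠ 0 := hi
  positivity

/-- As Σ y_j = 0, the logarithmic derivative Σ y_j/(1 + y_j u) equals -u Σ y_j²/(1 + y_j u); this
isolates the only critical point u = 0. -/
theorem hasDerivAt_prod {y : Fin m → ℝ} (hs : ∑ j, y j = 0) {u : ℝ} (hu : u ∈ dom y) :
    HasDerivAt (fun u => ∏ j, (1 + y j * u)) (-(u * (∏ j, (1 + y j * u)) * curv y u)) u := by
  have h1 : ∀ j ∈ Finset.univ, HasDerivAt (fun u => 1 + y j * u) (y j) u := fun j _ => by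
    simpa using ((hasDerivAt_id u).const_mul (y j)).const_add 1
  refine (HasDerivAt.fun_finsetProd h1).congr_deriv ?_
  have h2 : ∀ j ∈ Finset.univ, (∏ i ∈ Finset.univ.erase j, (1 + y i * u)) • y j
      = (∏ i, (1 + y i * u)) * (y j - u * (y j ^ 2 / (1 + y j * u))) := by
    intro j hj
    rw [← Finset.mul_prod_erase _ _ hj, smul_eq_mul]
    have h3 : 1 + y j * u ≠ 0 := (hu j).ne'
    have h4 : (1 + y j * u) * (y j - u * (y j ^ 2 / (1 + y j * u))) = y j := by
      field_simp
      ring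
    linear_combination -(∏ i ∈ Finset.univ.erase j, (1 + y i * u)) * h4
  rw [Finset.sum_congr rfl h2, ← Finset.mul_sum, Finset.sum_sub_distrib, hs, ← Finset.mul_sum,
    ← curv]
  ring

/-- Compare each factor with exp (y_j u); the exponents sum to zero. -/
theorem prod_lt_one {y : Fin m → ℝ} (hs : ∑ j, y j = 0) (hy : y ≠ 0) {u : ℝ} (hu : u ∈ dom y)
    (hu0 : u ≠ 0) : ∏ j, (1 + y j * u) < 1 := by
  obtain ⟨i, hi⟩ := Function.ne_iff.1 hy
  calc ∏ j, (1 + y j * u) < ∏ j, Real.exp (y j * u) := by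
        refine Finset.prod_lt_prod (fun j _ => hu j) (fun j _ => ?_) ⟨i, Finset.mem_univ i, ?_⟩
        · rw [add_comm]; exact Real.add_one_le_exp _
        · rw [add_comm]; exact Real.add_one_lt_exp (mul_ne_zero hi hu0)
    _ = 1 := by rw [← Real.exp_sum, ← Finset.sum_mul, hs]; simp

theorem remainder_pos {y : Fin m → ℝ} (hs : ∑ j, y j = 0) (hy : y ≠ 0) {u : ℝ}
    (hu : u ∈ dom y) : 0 < remainder (y, u) := by
  by_cases hu0 : u = 0
  · subst hu0
    rw [remainder_zero hs]
    linarith [sum_sq_pos hy]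
  · have h1 := prod_lt_one hs hy hu hu0
    rw [prod_eq_remainder hs] at h1
    have h2 : 0 < u ^ 2 := by positivity
    by_contra! h3
    nlinarith [mul_nonneg h2.le (neg_nonneg.2 h3)]

theorem prod_eq_morse {y : Fin m → ℝ} (hs : ∑ j, y j = 0) (hy : y ≠ 0) {u : ℝ}
    (hu : u ∈ dom y) : ∏ j, (1 + y j * u) = 1 - morse y u ^ 2 := by
  rw [prod_eq_remainder hs, morse, mul_pow, Real.sq_sqrt (remainder_pos hs hy hu).le]

theorem morse_sq_lt_one {y : Fin m → ℝ} (hs : ∑ j, y j = 0) (hy : y ≠ 0) {u : ℝ}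
    (hu : u ∈ dom y) : morse y u ^ 2 < 1 := by
  have := prod_pos_of_mem hu
  rw [prod_eq_morse hs hy hu] at this
  linarith

theorem differentiableAt_remainder (y : Fin m → ℝ) (u : ℝ) :
    DifferentiableAt ℝ (fun u => remainder (y, u)) u :=
  DifferentiableAt.comp (f := fun u : ℝ => (y, u)) u
    (analyticAt_remainder (y, u)).differentiableAt (by fun_prop)

/-- Differentiate 1 - u² R in two ways and cancel u. The left side is the numerator of the
derivative of u √R, so this is what makes `morse` strictly increasing. -/
theorem two_mul_remainder_add {y : Fin m → ℝ} (hs : ∑ j, y j = 0) {u : ℝ} (hu : u ∈ dom y) :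
    2 * remainder (y, u) + u * deriv (fun u => remainder (y, u)) u
      = (∏ j, (1 + y j * u)) * curv y u := by
  by_cases hu0 : u = 0
  · subst hu0
    simp [remainder_zero hs, curv]
    ring
  · have h1 := hasDerivAt_prod hs hu
    have h2 : HasDerivAt (fun u => 1 - u ^ 2 * remainder (y, u))
        (-(2 * u * remainder (y, u) + u ^ 2 * deriv (fun u => remainder (y, u)) u)) u := by
      have := ((hasDerivAt_pow 2 u).mul (differentiableAt_remainder y u).hasDerivAt).const_sub 1
      simpa using this
    have h3 : (fun u => ∏ j, (1 + y j * u)) = fun u => 1 - u ^ 2 * remainder (y, u) :=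
      funext fun u => prod_eq_remainder hs u
    rw [h3] at h1
    have h4 := h1.unique h2
    apply mul_left_cancel₀ hu0
    linear_combination h4

theorem hasDerivAt_morse {y : Fin m → ℝ} (hs : ∑ j, y j = 0) (hy : y ≠ 0) {u : ℝ}
    (hu : u ∈ dom y) : HasDerivAt (morse y)
      ((1 - morse y u ^ 2) * curv y u / (2 * √(remainder (y, u)))) u := by
  have hR := remainder_pos hs hy hu
  have h1 := (hasDerivAt_id u).mul ((differentiableAt_remainder y u).hasDerivAt.sqrt hR.ne')
  refine h1.congr_deriv ?_
  rw [← prod_eq_morse hs hy hu, ← two_mul_remainder_add hs hu]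
  have h2 : 0 < √(remainder (y, u)) := Real.sqrt_pos.2 hR
  have h3 := Real.mul_self_sqrt hR.le
  simp only [id]
  field_simp
  linear_combination 2 * h3

theorem deriv_morse_pos {y : Fin m → ℝ} (hs : ∑ j, y j = 0) (hy : y ≠ 0) {u : ℝ}
    (hu : u ∈ dom y) : 0 < (1 - morse y u ^ 2) * curv y u / (2 * √(remainder (y, u))) := by
  have := Real.sqrt_pos.2 (remainder_pos hs hy hu)
  have := curv_pos hy hu
  have := morse_sq_lt_one hs hy hu
  have : 0 < 1 - morse y u ^ 2 := by linarith
  positivity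

theorem strictMonoOn_morse {y : Fin m → ℝ} (hs : ∑ j, y j = 0) (hy : y ≠ 0) :
    StrictMonoOn (morse y) (dom y) := by
  refine strictMonoOn_of_deriv_pos (convex_dom y)
    (fun u hu => (hasDerivAt_morse hs hy hu).continuousAt.continuousWithinAt) fun u hu => ?_
  have hu := interior_subset hu
  rw [(hasDerivAt_morse hs hy hu).deriv]
  exact deriv_morse_pos hs hy hu

theorem exists_neg {y : Fin m → ℝ} (hs : ∑ j, y j = 0) (hy : y ≠ 0) : ∃ i, y i < 0 := by
  by_contra! h
  apply hy
  funext j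
  exact (Finset.sum_eq_zero_iff_of_nonneg fun j _ => h j).1 hs j (Finset.mem_univ j)

theorem exists_endpoint {y : Fin m → ℝ} (hs : ∑ j, y j = 0) (hy : y ≠ 0) :
    ∃ b > 0, Ico 0 b ⊆ dom y ∧ ∏ j, (1 + y j * b) = 0 := by
  obtain ⟨i₀, hi₀⟩ := exists_neg hs hy
  obtain ⟨i, hi⟩ := haveI : Nonempty (Fin m) := ⟨i₀⟩; Finite.exists_min y
  have hi0 : y i < 0 := (hi i₀).trans_lt hi₀
  -- The factor with the most negative y_i is the first to vanish as u grows.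
  refine ⟨-(1 / y i), by simpa using hi0, ?_, ?_⟩
  · rintro u ⟨hu0, hu⟩ j
    have h1 : 0 < 1 + y i * u := by
      have := mul_lt_mul_of_neg_left hu hi0
      have h2 : y i * -(1 / y i) = -1 := by have := hi0.ne; field_simp
      linarith
    have := mul_le_mul_of_nonneg_right (hi j) hu0
    linarith
  · refine Finset.prod_eq_zero (Finset.mem_univ i) ?_
    have := hi0.ne
    field_simp
    norm_num

theorem exists_morse_eq_of_nonneg {y : Fin m → ℝ} (hs : ∑ j, y j = 0) (hy : y ≠ 0) {x : ℝ}
    (hx0 : 0 ≤ x) (hx : x < 1) : ∃ u ∈ dom y, morse y u ^ 2 = x ^ 2 ∧ 0 ≤ u := by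
  obtain ⟨b, hb, hd, hq⟩ := exists_endpoint hs hy
  have hc : ContinuousOn (fun u => ∏ j, (1 + y j * u)) (Icc 0 b) := by fun_prop
  have h1 := intermediate_value_Ico' hb.le hc
  have hx2 : x ^ 2 < 1 := by nlinarith
  obtain ⟨u, hu, hux⟩ := h1 (show 1 - x ^ 2 ∈ _ by
    rw [hq]
    simp only [mul_zero, add_zero, Finset.prod_const_one]
    exact ⟨by linarith, by nlinarith⟩)
  refine ⟨u, hd hu, ?_, hu.1⟩
  have := prod_eq_morse hs hy (hd hu)
  simp only at hux
  linarith

theorem neg_mem_dom {y : Fin m → ℝ} {u : ℝ} (hu : u ∈ dom (-y)) : -u ∈ dom y := fun j => by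
  have := hu j
  simp only [Pi.neg_apply] at this
  linarith

/-- The product falls continuously from 1 to 0 on the positive half of the interval, so the
intermediate value theorem gives x ≥ 0; negative x follows from the symmetry (y, u) ↦ (-y, -u). -/
theorem exists_morse_eq {y : Fin m → ℝ} (hs : ∑ j, y j = 0) (hy : y ≠ 0) {x : ℝ}
    (hx : |x| < 1) : ∃ u ∈ dom y, morse y u = x := by
  rcases le_total 0 x with hx0 | hx0
  · rw [abs_of_nonneg hx0] at hx
    obtain ⟨u, hu, h1, h2⟩ := exists_morse_eq_of_nonneg hs hy hx0 hx
    refine ⟨u, hu, ?_⟩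
    exact (pow_left_inj₀ (mul_nonneg h2 (Real.sqrt_nonneg _)) hx0 two_ne_zero).1 h1
  · rw [abs_of_nonpos hx0] at hx
    have hs' : ∑ j, (-y) j = 0 := by simp [hs]
    have hy' : -y ≠ 0 := neg_ne_zero.2 hy
    obtain ⟨u, hu, h1, h2⟩ := exists_morse_eq_of_nonneg hs' hy' (neg_nonneg.2 hx0) hx
    refine ⟨-u, neg_mem_dom hu, ?_⟩
    have h3 := prod_eq_morse hs' hy' hu
    have h4 := prod_eq_morse hs hy (neg_mem_dom hu)
    have h5 : morse y (-u) ^ 2 = (-x) ^ 2 := by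
      rw [← h1]
      simp only [Pi.neg_apply, neg_mul, mul_neg] at h3 h4
      linarith
    have h6 : 0 ≤ -morse y (-u) := by
      have := mul_nonneg h2 (Real.sqrt_nonneg (remainder (y, -u)))
      simp only [morse]; linarith
    have h7 : (-morse y (-u)) ^ 2 = (-x) ^ 2 := by rw [neg_sq, h5]
    have := (pow_left_inj₀ h6 (neg_nonneg.2 hx0) two_ne_zero).1 h7
    linarith

open Classical in
/-- The inverse of the Morse coordinate. -/
noncomputable def invMorse (y : Fin m → ℝ) (x : ℝ) : ℝ :=
  if h : ∃ u ∈ dom y, morse y u = x then h.choose else 0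

theorem invMorse_mem {y : Fin m → ℝ} (hs : ∑ j, y j = 0) (hy : y ≠ 0) {x : ℝ}
    (hx : |x| < 1) : invMorse y x ∈ dom y := by
  have h := exists_morse_eq hs hy hx
  rw [invMorse, dif_pos h]
  exact h.choose_spec.1

theorem morse_invMorse {y : Fin m → ℝ} (hs : ∑ j, y j = 0) (hy : y ≠ 0) {x : ℝ}
    (hx : |x| < 1) : morse y (invMorse y x) = x := by
  have h := exists_morse_eq hs hy hx
  rw [invMorse, dif_pos h]
  exact h.choose_spec.2

theorem abs_morse_lt_one {y : Fin m → ℝ} (hs : ∑ j, y j = 0) (hy : y ≠ 0) {u : ℝ}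
    (hu : u ∈ dom y) : |morse y u| < 1 :=
  (sq_lt_one_iff_abs_lt_one _).1 (morse_sq_lt_one hs hy hu)

theorem invMorse_eq {y : Fin m → ℝ} (hs : ∑ j, y j = 0) (hy : y ≠ 0) {u x : ℝ}
    (hu : u ∈ dom y) (h : morse y u = x) : invMorse y x = u := by
  have hx : |x| < 1 := h ▸ abs_morse_lt_one hs hy hu
  exact (strictMonoOn_morse hs hy).injOn (invMorse_mem hs hy hx) hu
    ((morse_invMorse hs hy hx).trans h.symm)

theorem invMorse_zero {y : Fin m → ℝ} (hs : ∑ j, y j = 0) (hy : y ≠ 0) : invMorse y 0 = 0 :=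
  invMorse_eq hs hy (zero_mem_dom y) (by simp [morse])

/-- The derivative of `invMorse y`, as an explicit expression. -/
noncomputable def dInvMorse (y : Fin m → ℝ) (x : ℝ) : ℝ :=
  2 * √(remainder (y, invMorse y x)) / ((1 - x ^ 2) * curv y (invMorse y x))

theorem one_sub_sq_pos {x : ℝ} (hx : |x| < 1) : 0 < 1 - x ^ 2 := by
  have := (sq_lt_one_iff_abs_lt_one x).2 hx
  linarith

theorem dInvMorse_pos {y : Fin m → ℝ} (hs : ∑ j, y j = 0) (hy : y ≠ 0) {x : ℝ}
    (hx : |x| < 1) : 0 < dInvMorse y x := by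
  have h := invMorse_mem hs hy hx
  have := Real.sqrt_pos.2 (remainder_pos hs hy h)
  have := curv_pos hy h
  have := one_sub_sq_pos hx
  unfold dInvMorse
  positivity

theorem hasDerivAt_morse' {y : Fin m → ℝ} (hs : ∑ j, y j = 0) (hy : y ≠ 0) {u : ℝ}
    (hu : u ∈ dom y) : HasDerivAt (morse y) (dInvMorse y (morse y u))⁻¹ u := by
  refine (hasDerivAt_morse hs hy hu).congr_deriv ?_
  rw [dInvMorse, invMorse_eq hs hy hu rfl, inv_div]

theorem analyticAt_coord {z : hyperplane m × ℝ} (j : Fin m) :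
    AnalyticAt ℝ (fun z : hyperplane m × ℝ => (z.1 : Fin m → ℝ) j) z :=
  ((ContinuousLinearMap.proj (R := ℝ) (φ := fun _ : Fin m => ℝ) j).comp
    ((hyperplane m).subtypeL.comp (ContinuousLinearMap.fst ℝ (hyperplane m) ℝ))).analyticAt z

theorem analyticAt_sqrt_comp {E : Type*} [NormedAddCommGroup E] [NormedSpace ℝ E] {f : E → ℝ}
    {z : E} (hf : AnalyticAt ℝ f z) (h : f z ≠ 0) : AnalyticAt ℝ (fun z => √(f z)) z :=
  (hf.contDiffAt.sqrt h).analyticAt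

theorem sum_coe (y : hyperplane m) : ∑ j, (y : Fin m → ℝ) j = 0 := y.2

theorem coe_ne_zero {y : hyperplane m} (hy : y ≠ 0) : (y : Fin m → ℝ) ≠ 0 := by simpa using hy

/-- Analytic implicit function theorem for `morse y u - x = 0`. Since `morse y` is injective on `dom
y`, the local solution coincides with the globally chosen inverse as long as it stays in the domain.
-/
theorem analyticAt_invMorse {y : hyperplane m} (hy : y ≠ 0) {x : ℝ} (hx : |x| < 1) :
    AnalyticAt ℝ (fun z : hyperplane m × ℝ => invMorse (z.1 : Fin m → ℝ) z.2) (y, x) := by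
  set u := invMorse (y : Fin m → ℝ) x with hu
  have hum : u ∈ dom (y : Fin m → ℝ) := invMorse_mem (sum_coe y) (coe_ne_zero hy) hx
  have hux : morse (y : Fin m → ℝ) u = x := morse_invMorse (sum_coe y) (coe_ne_zero hy) hx
  let f : (hyperplane m × ℝ) × ℝ → ℝ := fun z => morse (z.1.1 : Fin m → ℝ) z.2 - z.1.2
  let π : (hyperplane m × ℝ) × ℝ →L[ℝ] (Fin m → ℝ) × ℝ :=
    ((hyperplane m).subtypeL.comp ((ContinuousLinearMap.fst ℝ (hyperplane m) ℝ).comp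
      (ContinuousLinearMap.fst ℝ (hyperplane m × ℝ) ℝ))).prod
      (ContinuousLinearMap.snd ℝ (hyperplane m × ℝ) ℝ)
  have hf : AnalyticAt ℝ f ((y, x), u) := by
    have h1 : AnalyticAt ℝ (fun z : (hyperplane m × ℝ) × ℝ => √(remainder (π z))) ((y, x), u) :=
      analyticAt_sqrt_comp
        (AnalyticAt.comp (analyticAt_remainder _) (π.analyticAt ((y, x), u)))
        (remainder_pos (sum_coe y) (coe_ne_zero hy) hum).ne'
    exact (analyticAt_snd.mul h1).sub
      (((ContinuousLinearMap.snd ℝ (hyperplane m) ℝ).comp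
        (ContinuousLinearMap.fst ℝ (hyperplane m × ℝ) ℝ)).analyticAt _)
  have hf0 : f ((y, x), u) = 0 := by simp [f, hux]
  have hd := hasDerivAt_morse (sum_coe y) (coe_ne_zero hy) hum
  have hpos := deriv_morse_pos (sum_coe y) (coe_ne_zero hy) hum
  set d := (1 - morse (y : Fin m → ℝ) u ^ 2) * curv (y : Fin m → ℝ) u /
    (2 * √(remainder ((y : Fin m → ℝ), u)))
  have hcd : ContDiffAt ℝ ⊤ f ((y, x), u) := hf.contDiffAt
  have hinv : (fderiv ℝ f ((y, x), u) ∘L .inr ℝ (hyperplane m × ℝ) ℝ).IsInvertible := by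
    refine ⟨ContinuousLinearEquiv.unitsEquivAut ℝ (Units.mk0 d hpos.ne'), ?_⟩
    ext
    have h1 : HasFDerivAt (fun v : ℝ => f ((y, x), v))
        (fderiv ℝ f ((y, x), u) ∘L .inr ℝ (hyperplane m × ℝ) ℝ) u :=
      HasFDerivAt.comp u hf.differentiableAt.hasFDerivAt (hasFDerivAt_prodMk_right (y, x) u)
    have h2 : HasDerivAt (fun v : ℝ => f ((y, x), v)) d u := hd.sub_const x
    have := h1.hasDerivAt.unique h2
    simpa using this.symm
  have htop : (⊤ : WithTop ℕ∞) ≠ 0 := by simp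
  have h1 := hcd.contDiffAt_implicitFunction htop hinv
  refine h1.analyticAt.congr ?_
  have h2 := hcd.eventually_apply_implicitFunction htop hinv
  have h3 := hcd.implicitFunction_apply_self htop hinv
  have h4 : ∀ᶠ z in 𝓝 ((y, x) : hyperplane m × ℝ),
      hcd.implicitFunction htop hinv z ∈ dom (z.1 : Fin m → ℝ) := by
    have h5 : ContinuousAt (fun z : hyperplane m × ℝ =>
        ((z.1 : Fin m → ℝ), hcd.implicitFunction htop hinv z)) (y, x) :=
      ContinuousAt.prodMk (by fun_prop) h1.continuousAt
    refine h5.preimage_mem_nhds (isOpen_dom_prod.mem_nhds ?_)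
    simp only [mem_ofPred_eq]
    rw [h3]
    exact hum
  have h6 : ∀ᶠ z in 𝓝 ((y, x) : hyperplane m × ℝ), z.1 ≠ 0 :=
    (continuousAt_fst).eventually_ne hy
  filter_upwards [h2, h4, h6] with z hz1 hz2 hz3
  rw [hf0] at hz1
  refine (invMorse_eq (sum_coe z.1) (coe_ne_zero hz3) hz2 ?_).symm
  simpa [f, sub_eq_zero] using hz1

theorem hasDerivAt_invMorse {y : Fin m → ℝ} (hs : ∑ j, y j = 0) (hy : y ≠ 0) {x : ℝ}
    (hx : |x| < 1) : HasDerivAt (invMorse y) (dInvMorse y x) x := by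
  have h1 := analyticAt_invMorse (y := (⟨y, hs⟩ : hyperplane m))
    (fun h => hy (congrArg Subtype.val h)) hx
  have hc : ContinuousAt (invMorse y) x :=
    ContinuousAt.comp (f := fun x : ℝ => ((⟨y, hs⟩ : hyperplane m), x)) h1.continuousAt
      (by fun_prop)
  have h2 := hasDerivAt_morse' hs hy (invMorse_mem hs hy hx)
  rw [morse_invMorse hs hy hx] at h2
  have h3 := HasDerivAt.of_local_left_inverse hc h2 (inv_ne_zero (dInvMorse_pos hs hy hx).ne') (by
    have : ∀ᶠ x' in 𝓝 x, |x'| < 1 := continuous_abs.continuousAt.eventually_lt_const hx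
    filter_upwards [this] with x' hx'
    exact morse_invMorse hs hy hx')
  simpa using h3

end Morse

/-! ### The integral formula for the shift and its analyticity -/

section ShiftMap

variable {m : ℕ}

theorem analyticAt_dInvMorse {y : hyperplane m} (hy : y ≠ 0) {x : ℝ} (hx : |x| < 1) :
    AnalyticAt ℝ (fun z : hyperplane m × ℝ => dInvMorse (z.1 : Fin m → ℝ) z.2) (y, x) := by
  have hψ := analyticAt_invMorse hy hx
  have hm := invMorse_mem (sum_coe y) (coe_ne_zero hy) hx
  have h1 : AnalyticAt ℝ (fun z : hyperplane m × ℝ =>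
      ((z.1 : Fin m → ℝ), invMorse (z.1 : Fin m → ℝ) z.2)) (y, x) :=
    (((hyperplane m).subtypeL.comp (ContinuousLinearMap.fst ℝ (hyperplane m) ℝ)).analyticAt
      (y, x)).prod hψ
  have h2 : AnalyticAt ℝ (fun z : hyperplane m × ℝ =>
      √(remainder ((z.1 : Fin m → ℝ), invMorse (z.1 : Fin m → ℝ) z.2))) (y, x) :=
    analyticAt_sqrt_comp (AnalyticAt.comp (g := remainder (m := m)) (analyticAt_remainder _) h1)
      (remainder_pos (sum_coe y) (coe_ne_zero hy) hm).ne'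
  have h3 : AnalyticAt ℝ (fun z : hyperplane m × ℝ =>
      curv (z.1 : Fin m → ℝ) (invMorse (z.1 : Fin m → ℝ) z.2)) (y, x) := by
    refine Finset.analyticAt_fun_sum _ fun j _ => AnalyticAt.div ((analyticAt_coord j).pow 2)
      (analyticAt_const.add ((analyticAt_coord j).mul hψ)) (hm j).ne'
  refine AnalyticAt.div (analyticAt_const.mul h2)
    ((analyticAt_const.sub (analyticAt_snd.pow 2)).mul h3) ?_
  exact mul_ne_zero (one_sub_sq_pos hx).ne' (curv_pos (coe_ne_zero hy) hm).ne'

/-- The density of the `j`-th period shift in the Morse coordinate. -/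
noncomputable def kern (y : Fin m → ℝ) (j : Fin m) (x : ℝ) : ℝ :=
  y j * dInvMorse y x / (1 + y j * invMorse y x)

theorem analyticAt_kern {y : hyperplane m} (hy : y ≠ 0) {x : ℝ} (hx : |x| < 1) (j : Fin m) :
    AnalyticAt ℝ (fun z : hyperplane m × ℝ => kern (z.1 : Fin m → ℝ) j z.2) (y, x) :=
  AnalyticAt.div ((analyticAt_coord j).mul (analyticAt_dInvMorse hy hx))
    (analyticAt_const.add ((analyticAt_coord j).mul (analyticAt_invMorse hy hx)))
    (invMorse_mem (sum_coe y) (coe_ne_zero hy) hx j).ne'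

theorem continuousAt_kern {y : Fin m → ℝ} (hs : ∑ j, y j = 0) (hy : y ≠ 0) {x : ℝ}
    (hx : |x| < 1) (j : Fin m) : ContinuousAt (kern y j) x :=
  ContinuousAt.comp (f := fun x : ℝ => ((⟨y, hs⟩ : hyperplane m), x))
    (analyticAt_kern (y := ⟨y, hs⟩) (fun h => hy (congrArg Subtype.val h)) hx j).continuousAt
    (by fun_prop)

theorem continuousAt_dInvMorse {y : Fin m → ℝ} (hs : ∑ j, y j = 0) (hy : y ≠ 0) {x : ℝ}
    (hx : |x| < 1) : ContinuousAt (dInvMorse y) x :=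
  ContinuousAt.comp (f := fun x : ℝ => ((⟨y, hs⟩ : hyperplane m), x))
    (analyticAt_dInvMorse (y := ⟨y, hs⟩) (fun h => hy (congrArg Subtype.val h)) hx).continuousAt
    (by fun_prop)

theorem abs_mul_sin_lt {c : ℝ} (hc : |c| < 1) (s : ℝ) : |c * Real.sin s| < 1 := by
  rw [abs_mul]
  exact lt_of_le_of_lt (mul_le_of_le_one_right (abs_nonneg _) (Real.abs_sin_le_one s)) hc

theorem continuous_comp_mul_sin {f : ℝ → ℝ} (hf : ∀ x, |x| < 1 → ContinuousAt f x) {c : ℝ}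
    (hc : |c| < 1) : Continuous fun s => f (c * Real.sin s) :=
  continuous_iff_continuousAt.2 fun s =>
    ContinuousAt.comp (f := fun s => c * Real.sin s) (hf _ (abs_mul_sin_lt hc s)) (by fun_prop)

theorem continuous_kern_sin {y : Fin m → ℝ} (hs : ∑ j, y j = 0) (hy : y ≠ 0) {c : ℝ}
    (hc : |c| < 1) (j : Fin m) : Continuous fun s => kern y j (c * Real.sin s) :=
  continuous_comp_mul_sin (fun _ hx => continuousAt_kern hs hy hx j) hc

theorem continuous_dInvMorse_sin {y : Fin m → ℝ} (hs : ∑ j, y j = 0) (hy : y ≠ 0) {c : ℝ}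
    (hc : |c| < 1) : Continuous fun s => dInvMorse y (c * Real.sin s) :=
  continuous_comp_mul_sin (fun _ hx => continuousAt_dInvMorse hs hy hx) hc

/-- `kern y j` is the x-derivative of log (1 + y_j u) along u = `invMorse y x`, and these logarithms
add up to log (1 - x²). The sum is odd in x, which is why the total shift vanishes. -/
theorem sum_kern {y : Fin m → ℝ} (hs : ∑ j, y j = 0) (hy : y ≠ 0) {x : ℝ} (hx : |x| < 1) :
    ∑ j, kern y j x = -(2 * x / (1 - x ^ 2)) := by
  have hm := invMorse_mem hs hy hx
  set u := invMorse y x with hu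
  have h1 : ∀ j, kern y j x = dInvMorse y x * (y j - u * (y j ^ 2 / (1 + y j * u))) := by
    intro j
    have := (hm j).ne'
    rw [kern, ← hu]
    field_simp
    ring
  simp only [h1, ← Finset.mul_sum, Finset.sum_sub_distrib, hs]
  rw [← curv]
  have h2 : u * √(remainder (y, u)) = x := morse_invMorse hs hy hx
  have h3 := (curv_pos hy hm).ne'
  have h4 := (one_sub_sq_pos hx).ne'
  rw [dInvMorse, ← hu]
  field_simp
  linear_combination (-curv y u) * h2

/-- The reflection s ↦ 2π - s changes the sign of the integrand. -/
theorem integral_odd_comp_sin {f : ℝ → ℝ} (hf : ∀ x, f (-x) = -f x) (c : ℝ) :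
    ∫ s in (0 : ℝ)..2 * Real.pi, f (c * Real.sin s) = 0 := by
  have h1 := intervalIntegral.integral_comp_sub_left (a := 0) (b := 2 * Real.pi)
    (fun s => f (c * Real.sin s)) (2 * Real.pi)
  simp only [Real.sin_two_pi_sub, mul_neg, hf, intervalIntegral.integral_neg, sub_self,
    sub_zero] at h1
  linarith

/-- The vector of period shifts as a function of `y_j = ± 1 / α_j` and the amplitude `c`. -/
noncomputable def shiftVec (y : Fin m → ℝ) (c : ℝ) (j : Fin m) : ℝ :=
  -(√(1 - c ^ 2) / 2) * ∫ s in (0 : ℝ)..2 * Real.pi, kern y j (c * Real.sin s)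

theorem sum_shiftVec {y : Fin m → ℝ} (hs : ∑ j, y j = 0) (hy : y ≠ 0) {c : ℝ} (hc : |c| < 1) :
    ∑ j, shiftVec y c j = 0 := by
  simp only [shiftVec, ← Finset.mul_sum]
  rw [← intervalIntegral.integral_finsetSum fun j _ =>
    (continuous_kern_sin hs hy hc j).intervalIntegrable _ _]
  simp only [sum_kern hs hy (abs_mul_sin_lt hc _)]
  rw [integral_odd_comp_sin (f := fun x => -(2 * x / (1 - x ^ 2))) (fun x => by ring), mul_zero]

/-- Apart from the factor y_j the density is positive; this fixes the signs that define V. -/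
theorem exists_shiftVec_eq_neg_mul {y : Fin m → ℝ} (hs : ∑ j, y j = 0) (hy : y ≠ 0) {c : ℝ}
    (hc : |c| < 1) (j : Fin m) : ∃ I > 0, shiftVec y c j = -(y j * I) := by
  refine ⟨√(1 - c ^ 2) / 2 * ∫ s in (0 : ℝ)..2 * Real.pi,
    dInvMorse y (c * Real.sin s) / (1 + y j * invMorse y (c * Real.sin s)), ?_, ?_⟩
  · have h0 := Real.sqrt_pos.2 (one_sub_sq_pos hc)
    refine mul_pos (by positivity) (intervalIntegral.intervalIntegral_pos_of_pos ?_ (fun s => ?_)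
      Real.two_pi_pos)
    · refine Continuous.intervalIntegrable ?_ _ _
      refine (continuous_dInvMorse_sin hs hy hc).div
        (continuous_const.add (continuous_const.mul (continuous_comp_mul_sin (fun x hx => ?_) hc)))
        fun s => (invMorse_mem hs hy (abs_mul_sin_lt hc s) j).ne'
      exact (hasDerivAt_invMorse hs hy hx).continuousAt
    · exact div_pos (dInvMorse_pos hs hy (abs_mul_sin_lt hc s))
        (invMorse_mem hs hy (abs_mul_sin_lt hc s) j)
  · simp only [shiftVec, kern, mul_div_assoc, intervalIntegral.integral_const_mul]
    ring

/-- The projection of `ℝ^m` onto the hyperplane `x_1 + ⋯ + x_m = 0` along `(1, …, 1)`. -/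
noncomputable def proj (m : ℕ) : (Fin m → ℝ) →L[ℝ] hyperplane m :=
  LinearMap.toContinuousLinearMap
    (LinearMap.codRestrict (hyperplane m)
      (LinearMap.id - LinearMap.pi fun _ => (m : ℝ)⁻¹ • ∑ i, LinearMap.proj i) (by
        intro x
        change ∑ j, _ = 0
        rcases Nat.eq_zero_or_pos m with rfl | hm
        · simp
        · have : (m : ℝ) ≠ 0 := by positivity
          simp [Finset.sum_sub_distrib, this]))

theorem proj_apply (x : Fin m → ℝ) (j : Fin m) :
    (proj m x : Fin m → ℝ) j = x j - (m : ℝ)⁻¹ * ∑ i, x i := by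
  simp [proj]

theorem coe_proj {x : Fin m → ℝ} (h : ∑ j, x j = 0) : (proj m x : Fin m → ℝ) = x := by
  funext j; simp [proj_apply, h]

theorem proj_coe (y : hyperplane m) : proj m (y : Fin m → ℝ) = y :=
  Subtype.ext (coe_proj y.2)

/-- The period shift map with values in the hyperplane `x_1 + ⋯ + x_m = 0`. -/
noncomputable def shiftMap (z : hyperplane m × ℝ) : hyperplane m :=
  proj m (shiftVec (z.1 : Fin m → ℝ) z.2)

theorem coe_shiftMap {y : hyperplane m} (hy : y ≠ 0) {c : ℝ} (hc : |c| < 1) :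
    (shiftMap (y, c) : Fin m → ℝ) = shiftVec (y : Fin m → ℝ) c :=
  coe_proj (sum_shiftVec (sum_coe y) (coe_ne_zero hy) hc)

theorem analyticAt_shiftVec {y : hyperplane m} (hy : y ≠ 0) {c : ℝ} (hc : |c| < 1) :
    AnalyticAt ℝ (fun z : hyperplane m × ℝ => shiftVec (z.1 : Fin m → ℝ) z.2) (y, c) := by
  refine AnalyticAt.pi fun j => ?_
  refine AnalyticAt.mul (((analyticAt_sqrt_comp (analyticAt_const.sub (analyticAt_snd.pow 2))
    (one_sub_sq_pos hc).ne').div_const).neg) ?_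
  refine analyticAt_integral (f := fun w : (hyperplane m × ℝ) × ℝ =>
    kern (w.1.1 : Fin m → ℝ) j (w.1.2 * Real.sin w.2)) (fun s => ?_) 0 (2 * Real.pi)
  have h1 : AnalyticAt ℝ (fun w : (hyperplane m × ℝ) × ℝ => (w.1.1, w.1.2 * Real.sin w.2))
      ((y, c), s) :=
    ((analyticAt_fst.comp analyticAt_fst)).prod ((analyticAt_snd.comp analyticAt_fst).mul
      (Real.analyticAt_sin.comp analyticAt_snd))
  exact AnalyticAt.fun_comp (g := fun z : hyperplane m × ℝ => kern (z.1 : Fin m → ℝ) j z.2)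
    (f := fun w : (hyperplane m × ℝ) × ℝ => (w.1.1, w.1.2 * Real.sin w.2))
    (analyticAt_kern hy (abs_mul_sin_lt hc s) j) h1

theorem analyticAt_shiftMap {y : hyperplane m} (hy : y ≠ 0) {c : ℝ} (hc : |c| < 1) :
    AnalyticAt ℝ (shiftMap (m := m)) (y, c) :=
  ((proj m).analyticAt _).comp (analyticAt_shiftVec hy hc)

theorem dInvMorse_zero {y : Fin m → ℝ} (hs : ∑ j, y j = 0) (hy : y ≠ 0) :
    dInvMorse y 0 = √2 / √(∑ j, y j ^ 2) := by
  have h := sum_sq_pos hy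
  rw [dInvMorse, invMorse_zero hs hy, remainder_zero hs]
  have h1 : curv y 0 = ∑ j, y j ^ 2 := by simp [curv]
  have h2 := Real.sqrt_pos.2 h
  have h3 : (0 : ℝ) < √2 := by positivity
  rw [h1, Real.sqrt_div h.le]
  nth_rewrite 2 [← Real.mul_self_sqrt h.le]
  field_simp
  nth_rewrite 1 [← Real.mul_self_sqrt (zero_le_two (α := ℝ))]
  ring

/-- At c = 0 the integrand is constant. The value depends only on the direction of y, so at c = 0
the radial direction is lost. -/
theorem shiftVec_zero {y : Fin m → ℝ} (hs : ∑ j, y j = 0) (hy : y ≠ 0) :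
    shiftVec y 0 = -(√2 * Real.pi / √(∑ j, y j ^ 2)) • y := by
  funext j
  simp [shiftVec, kern, invMorse_zero hs hy, dInvMorse_zero hs hy]
  ring

end ShiftMap

/-! ### The flow as a rotation in the (x, w)-plane -/

section Flow

variable {m : ℕ}

theorem integral_add_two_pi {f : ℝ → ℝ} (hf : Continuous f)
    (hp : Function.Periodic f (2 * Real.pi)) (S : ℝ) :
    ∫ s in (0 : ℝ)..(S + 2 * Real.pi), f s
      = (∫ s in (0 : ℝ)..S, f s) + ∫ s in (0 : ℝ)..2 * Real.pi, f s := by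
  have h1 := hp.intervalIntegral_add_eq S 0
  rw [zero_add] at h1
  rw [← h1, intervalIntegral.integral_add_adjacent_intervals (hf.intervalIntegrable _ _)
    (hf.intervalIntegrable _ _)]

/-- The time at which the solution with amplitude `c` reaches the angle `S`. -/
noncomputable def clock (y : Fin m → ℝ) (c κ S : ℝ) : ℝ :=
  ∫ s in (0 : ℝ)..S, dInvMorse y (c * Real.sin s) / (2 * κ)

/-- The increment of the `j`-th phase between the angles `0` and `S`. -/
noncomputable def phase (y : Fin m → ℝ) (c : ℝ) (j : Fin m) (S : ℝ) : ℝ :=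
  -(√(1 - c ^ 2) / 2) * ∫ s in (0 : ℝ)..S, kern y j (c * Real.sin s)

variable {y : Fin m → ℝ} {c κ : ℝ}

theorem hasDerivAt_clock (hs : ∑ j, y j = 0) (hy : y ≠ 0) (hc : |c| < 1) (S : ℝ) :
    HasDerivAt (clock y c κ) (dInvMorse y (c * Real.sin S) / (2 * κ)) S :=
  Continuous.integral_hasStrictDerivAt ((continuous_dInvMorse_sin hs hy hc).div_const _) 0 S
    |>.hasDerivAt

theorem hasDerivAt_phase (hs : ∑ j, y j = 0) (hy : y ≠ 0) (hc : |c| < 1) (j : Fin m) (S : ℝ) :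
    HasDerivAt (phase y c j) (-(√(1 - c ^ 2) / 2) * kern y j (c * Real.sin S)) S :=
  (Continuous.integral_hasStrictDerivAt (continuous_kern_sin hs hy hc j) 0 S
    |>.hasDerivAt).const_mul _

theorem clock_add_two_pi (hs : ∑ j, y j = 0) (hy : y ≠ 0) (hc : |c| < 1) (S : ℝ) :
    clock y c κ (S + 2 * Real.pi) = clock y c κ S + clock y c κ (2 * Real.pi) :=
  integral_add_two_pi ((continuous_dInvMorse_sin hs hy hc).div_const _)
    (fun s => by simp only [Real.sin_add_two_pi]) S

theorem phase_add_two_pi (hs : ∑ j, y j = 0) (hy : y ≠ 0) (hc : |c| < 1) (j : Fin m) (S : ℝ) :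
    phase y c j (S + 2 * Real.pi) = phase y c j S + shiftVec y c j := by
  rw [phase, integral_add_two_pi (continuous_kern_sin hs hy hc j)
    (fun s => by simp only [Real.sin_add_two_pi]) S, mul_add]
  rfl

theorem strictMono_clock (hs : ∑ j, y j = 0) (hy : y ≠ 0) (hc : |c| < 1) (hκ : 0 < κ) :
    StrictMono (clock y c κ) :=
  strictMono_of_hasDerivAt_pos (fun S => hasDerivAt_clock hs hy hc S) fun S =>
    div_pos (dInvMorse_pos hs hy (abs_mul_sin_lt hc S)) (by positivity)

theorem surjective_clock (hs : ∑ j, y j = 0) (hy : y ≠ 0) (hc : |c| < 1) (hκ : 0 < κ) :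
    Function.Surjective (clock y c κ) := by
  have hp : Function.Periodic (fun s => dInvMorse y (c * Real.sin s) / (2 * κ)) (2 * Real.pi) :=
    fun s => by simp only [Real.sin_add_two_pi]
  have hi : ∀ a b, IntervalIntegrable (fun s => dInvMorse y (c * Real.sin s) / (2 * κ)) volume a b :=
    fun a b => ((continuous_dInvMorse_sin hs hy hc).div_const _).intervalIntegrable a b
  have hpos : ∀ s, 0 < dInvMorse y (c * Real.sin s) / (2 * κ) := fun s =>
    div_pos (dInvMorse_pos hs hy (abs_mul_sin_lt hc s)) (by positivity)
  refine Continuous.surjective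
    (continuous_iff_continuousAt.2 fun S => (hasDerivAt_clock hs hy hc S).continuousAt) ?_ ?_
  · exact hp.tendsto_atTop_intervalIntegral_of_pos' (hi _ _) hpos Real.two_pi_pos
  · exact hp.tendsto_atBot_intervalIntegral_of_pos' (hi _ _) hpos Real.two_pi_pos

/-- The total phase as a function of the angle. -/
noncomputable def totalPhase (c S : ℝ) : ℝ :=
  Real.pi / 2 - Real.arctan (c * Real.cos S / √(1 - c ^ 2))

theorem one_sub_sq_sin_pos (hc : |c| < 1) (S : ℝ) : 0 < 1 - (c * Real.sin S) ^ 2 :=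
  one_sub_sq_pos (abs_mul_sin_lt hc S)

theorem sqrt_one_add_tan_sq (hc : |c| < 1) (S : ℝ) :
    √(1 + (c * Real.cos S / √(1 - c ^ 2)) ^ 2) = √(1 - (c * Real.sin S) ^ 2) / √(1 - c ^ 2) := by
  have h := one_sub_sq_pos hc
  rw [← Real.sqrt_div (one_sub_sq_sin_pos hc S).le, div_pow, Real.sq_sqrt h.le]
  congr 1
  have h' := h.ne'
  field_simp
  nlinarith [Real.sin_sq_add_cos_sq S]

/-- Together with `cos_totalPhase`: up to the factor κ, Q^{1/2} e^{iθ} equals c cos S + i √(1 - c²)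
at angle S. Its imaginary part is positive, so θ is an arctangent, 2π-periodic in S. -/
theorem sin_totalPhase (hc : |c| < 1) (S : ℝ) :
    √(1 - (c * Real.sin S) ^ 2) * Real.sin (totalPhase c S) = √(1 - c ^ 2) := by
  have h1 := Real.sqrt_pos.2 (one_sub_sq_pos hc)
  have h2 := Real.sqrt_pos.2 (one_sub_sq_sin_pos hc S)
  rw [totalPhase, Real.sin_pi_div_two_sub, Real.cos_arctan, sqrt_one_add_tan_sq hc]
  generalize √(1 - (c * Real.sin S) ^ 2) = z at *
  field_simp

theorem cos_totalPhase (hc : |c| < 1) (S : ℝ) :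
    √(1 - (c * Real.sin S) ^ 2) * Real.cos (totalPhase c S) = c * Real.cos S := by
  have h1 := Real.sqrt_pos.2 (one_sub_sq_pos hc)
  have h2 := Real.sqrt_pos.2 (one_sub_sq_sin_pos hc S)
  rw [totalPhase, Real.cos_pi_div_two_sub, Real.sin_arctan, sqrt_one_add_tan_sq hc]
  generalize √(1 - (c * Real.sin S) ^ 2) = z at *
  field_simp

theorem hasDerivAt_totalPhase (hc : |c| < 1) (S : ℝ) : HasDerivAt (totalPhase c)
    (√(1 - c ^ 2) * (c * Real.sin S) / (1 - (c * Real.sin S) ^ 2)) S := by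
  have h1 := Real.sqrt_pos.2 (one_sub_sq_pos hc)
  have h2 := one_sub_sq_sin_pos hc S
  have h3 := ((((Real.hasDerivAt_cos S).const_mul c).div_const (√(1 - c ^ 2))).arctan).const_sub
    (Real.pi / 2)
  refine h3.congr_deriv ?_
  have h4 : 1 + (c * Real.cos S / √(1 - c ^ 2)) ^ 2
      = (1 - (c * Real.sin S) ^ 2) / √(1 - c ^ 2) ^ 2 := by
    have h5 : √(1 - c ^ 2) ^ 2 = 1 - c ^ 2 := Real.sq_sqrt (one_sub_sq_pos hc).le
    field_simp
    rw [h5]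
    nlinarith [Real.sin_sq_add_cos_sq S]
  rw [h4]
  field_simp

theorem eq_add_const_of_hasDerivAt {f g f' : ℝ → ℝ} (hf : ∀ t, HasDerivAt f (f' t) t)
    (hg : ∀ t, HasDerivAt g (f' t) t) (t : ℝ) : f t = g t + (f 0 - g 0) := by
  have h : ∀ t, HasDerivAt (fun t => f t - g t) 0 t := fun t =>
    ((hf t).sub (hg t)).congr_deriv (sub_self _)
  have := is_const_of_deriv_eq_zero (fun t => (h t).differentiableAt) (fun t => (h t).deriv) t 0
  linarith

theorem sum_phase (hs : ∑ j, y j = 0) (hy : y ≠ 0) (hc : |c| < 1) (S : ℝ) :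
    ∑ j, phase y c j S = totalPhase c S - totalPhase c 0 := by
  have h1 : ∀ S, HasDerivAt (fun S => ∑ j, phase y c j S)
      (√(1 - c ^ 2) * (c * Real.sin S) / (1 - (c * Real.sin S) ^ 2)) S := fun S => by
    refine (HasDerivAt.fun_sum fun j _ => hasDerivAt_phase hs hy hc j S).congr_deriv ?_
    rw [← Finset.mul_sum, sum_kern hs hy (abs_mul_sin_lt hc S)]
    ring
  have h2 := eq_add_const_of_hasDerivAt h1 (hasDerivAt_totalPhase hc) S
  have h3 : ∑ j, phase y c j 0 = 0 := by simp [phase]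
  simp only [h3] at h2
  linarith

theorem exists_angle {x w : ℝ} (hc : 0 < c) (h : x ^ 2 + w ^ 2 = c ^ 2) :
    ∃ S, x = c * Real.sin S ∧ w = c * Real.cos S := by
  have hn : ‖(⟨w, x⟩ : ℂ)‖ = c := by
    rw [Complex.norm_def, Complex.normSq_mk, ← Real.sqrt_sq hc.le, ← h]
    congr 1; ring
  refine ⟨Complex.arg ⟨w, x⟩, ?_, ?_⟩
  · rw [← hn, Complex.norm_mul_sin_arg]
  · rw [← hn, Complex.norm_mul_cos_arg]

/-- The parameters of a solution in terms of `y_j = ± 1 / α_j`, the amplitude `c` and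
`κ = (α_1 ⋯ α_m)^{1/2}`. -/
structure Params (a : ℕ) (α : Fin m → ℝ) (A : ℝ) (y : Fin m → ℝ) (c κ : ℝ) : Prop where
  α_pos : ∀ j, 0 < α j
  y_eq : ∀ j, y j = sgn a j / α j
  sum_y : ∑ j, y j = 0
  y_ne : y ≠ 0
  c_pos : 0 < c
  c_lt : |c| < 1
  κ_pos : 0 < κ
  κ_sq : κ ^ 2 = ∏ j, α j
  A_eq : A = κ * √(1 - c ^ 2)

namespace Params

variable {a : ℕ} {α : Fin m → ℝ} {A : ℝ} (p : Params a α A y c κ)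

include p

theorem factor_eq (j : Fin m) (u : ℝ) : α j + sgn a j * u = α j * (1 + y j * u) := by
  have := (p.α_pos j).ne'
  rw [p.y_eq]; field_simp

theorem mem_dom {u : ℝ} : u ∈ dom y ↔ ∀ j, 0 < α j + sgn a j * u := by
  simp only [p.factor_eq, mul_pos_iff_of_pos_left (p.α_pos _)]
  rfl

theorem Q_eq {u : ℝ} (hu : u ∈ dom y) : Q a α u = κ ^ 2 * (1 - morse y u ^ 2) := by
  rw [Q, p.κ_sq, ← prod_eq_morse p.sum_y p.y_ne hu, ← Finset.prod_mul_distrib]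
  exact Finset.prod_congr rfl fun j _ => p.factor_eq j u

theorem sqrt_Q {u : ℝ} (hu : u ∈ dom y) : √(Q a α u) = κ * √(1 - morse y u ^ 2) := by
  rw [p.Q_eq hu, Real.sqrt_mul (sq_nonneg _), Real.sqrt_sq p.κ_pos.le]

theorem sgn_mul_div (j : Fin m) (u B : ℝ) :
    -sgn a j * (B / (α j + sgn a j * u)) = -(B * (y j / (1 + y j * u))) := by
  have h : sgn a j = y j * α j := by
    have := (p.α_pos j).ne'
    rw [p.y_eq]; field_simp
  have hα : α j * (α j)⁻¹ = 1 := mul_inv_cancel₀ (p.α_pos j).ne'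
  rw [p.factor_eq, h]
  simp only [div_eq_mul_inv, mul_inv]
  linear_combination (-(y j * B * (1 + y j * u)⁻¹)) * hα

/-- Inverting the clock gives the angle as a function of time, and everything else is explicit in
the angle. -/
theorem exists_isSolution : ∃ u θ, IsSolution a α A u θ := by
  have hτ := strictMono_clock p.sum_y p.y_ne p.c_lt p.κ_pos
  let e : ℝ ≃o ℝ := hτ.orderIsoOfSurjective _ (surjective_clock p.sum_y p.y_ne p.c_lt p.κ_pos)
  let σ : ℝ → ℝ := e.symm
  have hσ : ∀ t, clock y c κ (σ t) = t := fun t => e.apply_symm_apply t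
  have hd0 : ∀ t, 0 < dInvMorse y (c * Real.sin (σ t)) := fun t =>
    dInvMorse_pos p.sum_y p.y_ne (abs_mul_sin_lt p.c_lt _)
  have hκ := p.κ_pos
  have hσd : ∀ t, HasDerivAt σ (2 * κ / dInvMorse y (c * Real.sin (σ t))) t := fun t => by
    have := HasDerivAt.of_local_left_inverse (f := clock y c κ) (g := σ) (a := t)
      e.symm.continuous.continuousAt
      (hasDerivAt_clock p.sum_y p.y_ne p.c_lt (σ t))
      (div_pos (hd0 t) (by positivity)).ne' (.of_forall hσ)
    rwa [inv_div] at this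
  have hσ0 : σ 0 = 0 := by
    apply hτ.injective
    rw [hσ]; simp [clock]
  have hmem : ∀ t, invMorse y (c * Real.sin (σ t)) ∈ dom y := fun t =>
    invMorse_mem p.sum_y p.y_ne (abs_mul_sin_lt p.c_lt _)
  have hmor : ∀ t, morse y (invMorse y (c * Real.sin (σ t))) = c * Real.sin (σ t) := fun t =>
    morse_invMorse p.sum_y p.y_ne (abs_mul_sin_lt p.c_lt _)
  have hm : (m : ℝ) ≠ 0 := by
    rintro h
    have : m = 0 := by exact_mod_cast h
    subst this
    exact p.y_ne (Subsingleton.elim _ _)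
  have hsum : ∀ t, ∑ j, (totalPhase c 0 / m + phase y c j (σ t)) = totalPhase c (σ t) := fun t => by
    rw [Finset.sum_add_distrib, sum_phase p.sum_y p.y_ne p.c_lt]
    simp only [Finset.sum_const, Finset.card_univ, Fintype.card_fin, nsmul_eq_mul]
    field_simp
    ring
  have hsin : ∀ t, √(Q a α (invMorse y (c * Real.sin (σ t)))) * Real.sin (totalPhase c (σ t)) = A :=
    fun t => by
      rw [p.sqrt_Q (hmem t), hmor, mul_assoc, sin_totalPhase p.c_lt, p.A_eq]
  -- The initial total phase is divided equally among the m phases; only their sum is constrained.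
  refine ⟨fun t => invMorse y (c * Real.sin (σ t)),
    fun j t => totalPhase c 0 / m + phase y c j (σ t), fun t => p.mem_dom.1 (hmem t), fun t => ?_,
    fun j t => ?_, ?_⟩
  · rw [hsum, p.sqrt_Q (hmem t), hmor, mul_assoc 2, mul_assoc κ, cos_totalPhase p.c_lt]
    have h1 := (hasDerivAt_invMorse p.sum_y p.y_ne (abs_mul_sin_lt p.c_lt (σ t)))
    have h2 : HasDerivAt (fun t => c * Real.sin (σ t)) _ t := ((hσd t).sin).const_mul c
    refine (h1.comp t h2).congr_deriv ?_
    have := (hd0 t).ne'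
    field_simp
  · rw [hsum, hsin, p.sgn_mul_div]
    refine (((hasDerivAt_phase p.sum_y p.y_ne p.c_lt j (σ t)).comp t (hσd t)).const_add
      (totalPhase c 0 / m)).congr_deriv ?_
    have h1 := (hd0 t).ne'
    have h2 := (hmem t j).ne'
    rw [p.A_eq, kern]
    field_simp
  · rw [hsum, hsin]

/-- Every solution is the model rotation up to a time shift and constants in the θ_j, so one turn of
the angle gives the same increments for all of them. -/
theorem isShift : IsShift a (α, A) (shiftVec y c) := by
  refine ⟨p.exists_isSolution, fun u θ h => ?_⟩
  have hκ := p.κ_pos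
  have hm : ∀ t, u t ∈ dom y := fun t => p.mem_dom.2 (h.pos t)
  set Θ : ℝ → ℝ := fun t => ∑ i, θ i t with hΘ
  set r : ℝ → ℝ := fun t => √(Q a α (u t)) with hr
  -- The logarithmic derivative of Q at u. The radius r = Q^{1/2} and the angle Θ satisfy r' = l r²
  -- cos Θ and Θ' = -l r sin Θ, so r sin Θ is constant.
  set l : ℝ → ℝ := fun t => -(u t * curv y (u t)) with hl
  have hr2 : ∀ t, r t ^ 2 = κ ^ 2 * (1 - morse y (u t) ^ 2) := fun t => by
    rw [← p.Q_eq (hm t)]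
    refine Real.sq_sqrt ?_
    rw [p.Q_eq (hm t)]
    have := morse_sq_lt_one p.sum_y p.y_ne (hm t)
    have : 0 < 1 - morse y (u t) ^ 2 := by linarith
    positivity
  have hQd : ∀ t, HasDerivAt (Q a α) (l t * Q a α (u t)) (u t) := fun t => by
    have h1 := (hasDerivAt_prod p.sum_y (hm t)).const_mul (κ ^ 2)
    have h2 : Q a α = fun v => κ ^ 2 * ∏ j, (1 + y j * v) := by
      funext v
      rw [Q, p.κ_sq, ← Finset.prod_mul_distrib]
      exact Finset.prod_congr rfl fun j _ => p.factor_eq j v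
    rw [h2]
    refine h1.congr_deriv ?_
    simp only [hl]; ring
  have hQpos : ∀ t, 0 < Q a α (u t) := fun t => Finset.prod_pos fun j _ => h.pos t j
  have hrpos : ∀ t, 0 < r t := fun t => Real.sqrt_pos.2 (hQpos t)
  have hrd : ∀ t, HasDerivAt r (l t * r t ^ 2 * Real.cos (Θ t)) t := fun t => by
    have h1 := ((hQd t).comp t (h.hasDerivAt_u t)).sqrt (hQpos t).ne'
    refine h1.congr_deriv ?_
    have h2 : r t ^ 2 = Q a α (u t) := Real.sq_sqrt (hQpos t).le
    have h3 := (hrpos t).ne'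
    change l t * Q a α (u t) * (2 * r t * Real.cos (Θ t)) / (2 * r t) = _
    rw [← h2]
    field_simp
  have hΘd : ∀ t, HasDerivAt Θ (-(r t * Real.sin (Θ t) * l t)) t := fun t => by
    refine (HasDerivAt.fun_sum fun j _ => h.hasDerivAt_θ j t).congr_deriv ?_
    simp only [p.sgn_mul_div, Finset.sum_neg_distrib, ← Finset.mul_sum]
    have h1 : ∀ j, y j / (1 + y j * u t) = y j - u t * (y j ^ 2 / (1 + y j * u t)) := by
      intro j
      have := (hm t j).ne'
      field_simp
      ring
    simp only [h1, Finset.sum_sub_distrib, p.sum_y, ← Finset.mul_sum]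
    simp only [hl, curv, zero_sub]
    rfl
  have hA : ∀ t, r t * Real.sin (Θ t) = A := fun t => by
    have h1 : ∀ t, HasDerivAt (fun t => r t * Real.sin (Θ t)) 0 t := fun t => by
      refine ((hrd t).mul (hΘd t).sin).congr_deriv ?_
      ring
    have h2 := is_const_of_deriv_eq_zero (fun t => (h1 t).differentiableAt) (fun t => (h1 t).deriv)
      t 0
    exact h2.trans h.amplitude
  -- In these variables x' = k w and w' = -k x, and the conserved quantity fixes the radius: x² + w²
  -- = c².
  set x : ℝ → ℝ := fun t => morse y (u t) with hx
  set w : ℝ → ℝ := fun t => r t * Real.cos (Θ t) / κ with hw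
  set k : ℝ → ℝ := fun t => 2 * κ * (dInvMorse y (x t))⁻¹ with hk
  have hx1 : ∀ t, |x t| < 1 := fun t => abs_morse_lt_one p.sum_y p.y_ne (hm t)
  have hdpos : ∀ t, 0 < dInvMorse y (x t) := fun t => dInvMorse_pos p.sum_y p.y_ne (hx1 t)
  have hux : ∀ t, u t = invMorse y (x t) := fun t =>
    (invMorse_eq p.sum_y p.y_ne (hm t) rfl).symm
  have hxd : ∀ t, HasDerivAt x (k t * w t) t := fun t => by
    refine ((hasDerivAt_morse' p.sum_y p.y_ne (hm t)).comp t (h.hasDerivAt_u t)).congr_deriv ?_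
    simp only [hk, hw, hx]
    field_simp
    rfl
  have hwd : ∀ t, HasDerivAt w (-(k t * x t)) t := fun t => by
    refine (((hrd t).mul (hΘd t).cos).div_const κ).congr_deriv ?_
    have h1 : l t * r t ^ 2 * Real.cos (Θ t) * Real.cos (Θ t)
        + r t * (-Real.sin (Θ t) * -(r t * Real.sin (Θ t) * l t)) = l t * r t ^ 2 := by
      linear_combination l t * r t ^ 2 * Real.sin_sq_add_cos_sq (Θ t)
    rw [h1, hr2 t]
    have h2 := Real.sqrt_pos.2 (remainder_pos p.sum_y p.y_ne (hm t))
    have h3 : x t = u t * √(remainder (y, u t)) := rfl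
    simp only [hk, hl]
    rw [dInvMorse, ← hux t, inv_div]
    have h4 : morse y (u t) = x t := rfl
    rw [h4]
    nth_rewrite 3 [h3]
    field_simp
  have hxw : ∀ t, x t ^ 2 + w t ^ 2 = c ^ 2 := fun t => by
    have h1 : κ ^ 2 * (1 - c ^ 2) = A ^ 2 := by
      rw [p.A_eq, mul_pow, Real.sq_sqrt (one_sub_sq_pos p.c_lt).le]
    have h2 := hr2 t
    have h3 := hA t
    have h4 : w t * κ = r t * Real.cos (Θ t) := by simp only [hw]; field_simp
    have h5 := Real.sin_sq_add_cos_sq (Θ t)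
    have h6 : κ ^ 2 * (x t ^ 2 + w t ^ 2) = κ ^ 2 * c ^ 2 := by
      have h7 : (w t * κ) ^ 2 = r t ^ 2 - A ^ 2 := by
        rw [h4, ← h3]; linear_combination r t ^ 2 * h5
      have h8 : morse y (u t) = x t := rfl
      rw [h8] at h2
      linear_combination h7 + h2 + h1
    exact mul_left_cancel₀ (by positivity) h6
  obtain ⟨S₀, hS₀, hS₀'⟩ := exists_angle p.c_pos (hxw 0)
  have hkc : Continuous k := by
    refine continuous_iff_continuousAt.2 fun t => ?_
    refine ContinuousAt.mul continuousAt_const (ContinuousAt.inv₀ ?_ (hdpos t).ne')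
    exact ContinuousAt.comp (continuousAt_dInvMorse p.sum_y p.y_ne (hx1 t)) (hxd t).continuousAt
  -- Turning (x, w) back by the accumulated angle S gives a constant vector, whence x = c sin S and
  -- w = c cos S.
  set S : ℝ → ℝ := fun t => S₀ + ∫ s in (0 : ℝ)..t, k s with hS
  have hSd : ∀ t, HasDerivAt S (k t) t := fun t =>
    (hkc.integral_hasStrictDerivAt 0 t).hasDerivAt.const_add S₀
  have hS0 : S 0 = S₀ := by simp [hS]
  have hrot1 : ∀ t, x t * Real.cos (S t) - w t * Real.sin (S t) = 0 := fun t => by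
    have h1 : ∀ t, HasDerivAt (fun t => x t * Real.cos (S t) - w t * Real.sin (S t)) 0 t := fun t => by
      refine (((hxd t).mul (hSd t).cos).sub ((hwd t).mul (hSd t).sin)).congr_deriv ?_
      ring
    have h2 := is_const_of_deriv_eq_zero (fun t => (h1 t).differentiableAt) (fun t => (h1 t).deriv)
      t 0
    refine h2.trans ?_
    simp only [hS0]
    rw [hS₀, hS₀']; ring
  have hrot2 : ∀ t, x t * Real.sin (S t) + w t * Real.cos (S t) = c := fun t => by
    have h1 : ∀ t, HasDerivAt (fun t => x t * Real.sin (S t) + w t * Real.cos (S t)) 0 t := fun t => by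
      refine (((hxd t).mul (hSd t).sin).add ((hwd t).mul (hSd t).cos)).congr_deriv ?_
      ring
    have h2 := is_const_of_deriv_eq_zero (fun t => (h1 t).differentiableAt) (fun t => (h1 t).deriv)
      t 0
    refine h2.trans ?_
    simp only [hS0]
    rw [hS₀, hS₀']
    linear_combination c * Real.sin_sq_add_cos_sq S₀
  have hxS : ∀ t, x t = c * Real.sin (S t) := fun t => by
    linear_combination Real.cos (S t) * hrot1 t + Real.sin (S t) * hrot2 t
      - x t * Real.sin_sq_add_cos_sq (S t)
  have hwS : ∀ t, w t = c * Real.cos (S t) := fun t => by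
    linear_combination -Real.sin (S t) * hrot1 t + Real.cos (S t) * hrot2 t
      - w t * Real.sin_sq_add_cos_sq (S t)
  have hclock : ∀ t, clock y c κ (S t) = t + clock y c κ (S 0) := fun t => by
    have h1 : ∀ t, HasDerivAt (fun t => clock y c κ (S t)) 1 t := fun t => by
      refine ((hasDerivAt_clock p.sum_y p.y_ne p.c_lt (S t)).comp t (hSd t)).congr_deriv ?_
      simp only [hk]
      rw [hxS]
      have := hdpos t
      rw [hxS] at this
      field_simp
    have h2 := eq_add_const_of_hasDerivAt h1 hasDerivAt_id t
    simpa using h2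
  have hθ : ∀ j t, θ j t = phase y c j (S t) + (θ j 0 - phase y c j (S 0)) := fun j t => by
    refine eq_add_const_of_hasDerivAt (g := fun t => phase y c j (S t))
      (f' := fun t => -(A * (y j / (1 + y j * u t)))) (fun t => ?_) (fun t => ?_) t
    · have h1 := h.hasDerivAt_θ j t
      rw [p.sgn_mul_div] at h1
      rw [← hA t]
      exact h1
    · refine ((hasDerivAt_phase p.sum_y p.y_ne p.c_lt j (S t)).comp t (hSd t)).congr_deriv ?_
      simp only [hk]
      rw [← hxS, kern, ← hux, p.A_eq]
      have h1 := hdpos t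
      have h2 := hm t j
      field_simp
  have hmono := strictMono_clock p.sum_y p.y_ne p.c_lt p.κ_pos
  set T := clock y c κ (2 * Real.pi) with hT
  have hTpos : 0 < T := by
    have := hmono Real.two_pi_pos
    simpa [clock, hT] using this
  have hST : ∀ t, S (t + T) = S t + 2 * Real.pi := fun t => by
    apply hmono.injective
    rw [hclock, clock_add_two_pi p.sum_y p.y_ne p.c_lt, hclock t]
    ring
  have hθT : ∀ j t, θ j (t + T) = θ j t + shiftVec y c j := fun j t => by
    rw [hθ, hθ j t, hST, phase_add_two_pi p.sum_y p.y_ne p.c_lt]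
    ring
  refine ⟨T, ⟨⟨hTpos, fun t => ?_, fun t => ?_⟩, ?_⟩, hθT⟩
  · rw [hux, hux t, hxS, hxS, hST, Real.sin_add_two_pi]
  · simp only [hθT, Finset.sum_add_distrib, sum_shiftVec p.sum_y p.y_ne p.c_lt, add_zero]
  -- Periodicity of u alone suffices: it returns x, and through x' also w, so the increasing angle
  -- has advanced by a positive multiple of 2π.
  · rintro T' ⟨hT'pos, hT'u, -⟩
    have hSm : StrictMono S := strictMono_of_hasDerivAt_pos hSd fun t => by
      have := hdpos t
      simp only [hk]
      positivity
    have hxT : ∀ t, x (t + T') = x t := fun t => by simp only [hx]; rw [hT'u]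
    have h1 : Real.sin (S T') = Real.sin (S 0) := by
      have := hxT 0
      rw [zero_add, hxS, hxS 0] at this
      exact mul_left_cancel₀ p.c_pos.ne' this
    have h2 : Real.cos (S T') = Real.cos (S 0) := by
      have h3 : HasDerivAt (fun t => x (t + T')) (k T' * w T') 0 :=
        HasDerivAt.comp_add_const 0 T' (by simpa using hxd T')
      have h4 : (fun t => x (t + T')) = x := funext hxT
      rw [h4] at h3
      have h5 := h3.unique (hxd 0)
      have h6 : k T' = k 0 := by
        have := hxT 0
        rw [zero_add] at this
        simp only [hk, this]
      have h7 : k 0 ≠ 0 := by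
        have := hdpos 0
        simp only [hk]
        positivity
      rw [h6] at h5
      have h8 := mul_left_cancel₀ h7 h5
      rw [hwS, hwS 0] at h8
      exact mul_left_cancel₀ p.c_pos.ne' h8
    obtain ⟨n, hn⟩ := Real.Angle.angle_eq_iff_two_pi_dvd_sub.1 (Real.Angle.cos_sin_inj h2 h1)
    have h3 : 0 < S T' - S 0 := sub_pos.2 (hSm hT'pos)
    have hn1 : (1 : ℝ) ≤ n := by
      rw [hn] at h3
      have : 0 < (n : ℝ) := pos_of_mul_pos_right h3 Real.two_pi_pos.le
      exact_mod_cast this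
    have h4 : S 0 + 2 * Real.pi ≤ S T' := by nlinarith [Real.pi_pos]
    have h5 := hmono.monotone h4
    rw [clock_add_two_pi p.sum_y p.y_ne p.c_lt, hclock T'] at h5
    linarith

end Params

end Flow

/-! ### From (α, A) to (y, c) -/

section Parameters

/-- The vector `(± 1 / α_j)_j`, projected to the hyperplane. -/
noncomputable def recip (a : ℕ) {m : ℕ} (p : (Fin m → ℝ) × ℝ) : hyperplane m :=
  proj m fun j => sgn a j / p.1 j

/-- The amplitude `(1 - A ^ 2 / (α_1 ⋯ α_m))^{1/2}`. -/
noncomputable def amp {m : ℕ} (p : (Fin m → ℝ) × ℝ) : ℝ := √(1 - p.2 ^ 2 / ∏ j, p.1 j)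

variable {a m : ℕ}

theorem sgn_sq (a : ℕ) (j : Fin m) : sgn a j * sgn a j = 1 := by
  unfold sgn; split_ifs <;> norm_num

theorem balance_eq (p : (Fin m → ℝ) × ℝ) : balance a p = ∑ j, sgn a j / p.1 j := by
  have h : Finset.univ.filter (fun j : Fin m => a ≤ (j : ℕ))
      = Finset.univ.filter (fun j : Fin m => ¬ (j : ℕ) < a) := by
    ext j; simp
  rw [balance, h, ← Finset.sum_filter_add_sum_filter_not Finset.univ (fun j : Fin m => (j : ℕ) < a),
    sub_eq_add_neg, ← Finset.sum_neg_distrib]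
  congr 1
  · refine Finset.sum_congr rfl fun j hj => ?_
    rw [sgn, if_pos (Finset.mem_filter.1 hj).2]
  · refine Finset.sum_congr rfl fun j hj => ?_
    rw [sgn, if_neg (Finset.mem_filter.1 hj).2, neg_div]

theorem mem_U_iff (p : (Fin m → ℝ) × ℝ) : p ∈ U a m ↔ (∀ j, 0 < p.1 j) ∧
    ∑ j, sgn a j / p.1 j = 0 ∧ 0 < p.2 ∧ p.2 < √(∏ j, p.1 j) := by
  rw [← balance_eq, balance, sub_eq_zero]
  rfl

theorem coe_recip {p : (Fin m → ℝ) × ℝ} (hp : p ∈ U a m) :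
    (recip a p : Fin m → ℝ) = fun j => sgn a j / p.1 j :=
  coe_proj ((mem_U_iff p).1 hp).2.1

theorem amp_sq {p : (Fin m → ℝ) × ℝ} (hp : p ∈ U a m) :
    0 < 1 - p.2 ^ 2 / ∏ j, p.1 j ∧ 0 < p.2 ^ 2 / ∏ j, p.1 j := by
  obtain ⟨h1, -, h3, h4⟩ := (mem_U_iff p).1 hp
  have h5 : 0 < ∏ j, p.1 j := Finset.prod_pos fun j _ => h1 j
  have h6 : p.2 ^ 2 < ∏ j, p.1 j := (Real.lt_sqrt h3.le).1 h4
  refine ⟨?_, by positivity⟩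
  rw [sub_pos, div_lt_one h5]
  exact h6

theorem params_of_mem_U (hm : 0 < m) {p : (Fin m → ℝ) × ℝ} (hp : p ∈ U a m) :
    Params a p.1 p.2 (recip a p : Fin m → ℝ) (amp p) (√(∏ j, p.1 j)) := by
  obtain ⟨h1, h2, h3, h4⟩ := (mem_U_iff p).1 hp
  obtain ⟨h5, h6⟩ := amp_sq hp
  have h7 : 0 < ∏ j, p.1 j := Finset.prod_pos fun j _ => h1 j
  have h8 : 0 < amp p := Real.sqrt_pos.2 h5
  refine ⟨h1, fun j => by rw [coe_recip hp], sum_coe _, fun h => ?_, h8, ?_,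
    Real.sqrt_pos.2 h7, Real.sq_sqrt h7.le, ?_⟩
  · rw [coe_recip hp] at h
    have h9 := congrFun h ⟨0, hm⟩
    have h10 := sgn_sq a (⟨0, hm⟩ : Fin m)
    simp only [Pi.zero_apply, div_eq_zero_iff, (h1 _).ne', or_false] at h9
    rw [h9] at h10
    norm_num at h10
  · rw [abs_of_pos h8, amp, Real.sqrt_lt' one_pos]
    linarith
  · rw [amp, Real.sq_sqrt h5.le, sub_sub_cancel, Real.sqrt_div (sq_nonneg _), Real.sqrt_sq h3.le]
    have := Real.sqrt_pos.2 h7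
    field_simp

theorem isShift_of_mem_U (hm : 0 < m) {p : (Fin m → ℝ) × ℝ} (hp : p ∈ U a m) :
    IsShift a p (shiftVec (recip a p : Fin m → ℝ) (amp p)) :=
  (params_of_mem_U hm hp).isShift

theorem isShift_shift (hm : 0 < m) {p : (Fin m → ℝ) × ℝ} (hp : p ∈ U a m) :
    IsShift a p (shift a m p) := by
  have h : ∃ b, IsShift a p b := ⟨_, isShift_of_mem_U hm hp⟩
  rw [shift, dif_pos h]
  exact h.choose_spec

theorem shift_eq (hm : 0 < m) {p : (Fin m → ℝ) × ℝ} (hp : p ∈ U a m) :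
    shift a m p = shiftVec (recip a p : Fin m → ℝ) (amp p) :=
  (isShift_shift hm hp).unique (isShift_of_mem_U hm hp)

theorem recip_ne_zero (hm : 0 < m) {p : (Fin m → ℝ) × ℝ} (hp : p ∈ U a m) : recip a p ≠ 0 :=
  fun h => (params_of_mem_U hm hp).y_ne (by rw [h]; rfl)

theorem shift_eq_shiftMap (hm : 0 < m) {p : (Fin m → ℝ) × ℝ} (hp : p ∈ U a m) :
    shift a m p = (shiftMap (recip a p, amp p) : Fin m → ℝ) := by
  rw [shift_eq hm hp, coe_shiftMap (recip_ne_zero hm hp) (params_of_mem_U hm hp).c_lt]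

theorem analyticAt_coord_fst (p : (Fin m → ℝ) × ℝ) (j : Fin m) :
    AnalyticAt ℝ (fun p : (Fin m → ℝ) × ℝ => p.1 j) p :=
  ((ContinuousLinearMap.proj (R := ℝ) (φ := fun _ : Fin m => ℝ) j).comp
    (ContinuousLinearMap.fst ℝ (Fin m → ℝ) ℝ)).analyticAt p

theorem analyticAt_recip {p : (Fin m → ℝ) × ℝ} (hp : ∀ j, 0 < p.1 j) :
    AnalyticAt ℝ (recip a (m := m)) p :=
  ((proj m).analyticAt _).comp (AnalyticAt.pi fun j =>
    analyticAt_const.div (analyticAt_coord_fst p j) (hp j).ne')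

theorem analyticAt_amp {p : (Fin m → ℝ) × ℝ} (hp : p ∈ U a m) : AnalyticAt ℝ (amp (m := m)) p := by
  refine analyticAt_sqrt_comp (analyticAt_const.sub ((analyticAt_snd.pow 2).div
    (Finset.analyticAt_fun_prod _ fun j _ => analyticAt_coord_fst p j) ?_)) (amp_sq hp).1.ne'
  exact (Finset.prod_pos fun j _ => hp.1 j).ne'

/-- `shift` itself carries no information off U. Projecting y back to the hyperplane gives a formula
that is analytic in a full neighbourhood in ℝ^{m+1} and restricts to `shift` on U. -/
theorem analyticAt_shift_extension (hm : 0 < m) {p : (Fin m → ℝ) × ℝ} (hp : p ∈ U a m) :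
    AnalyticAt ℝ (fun p => shiftMap (recip a p, amp p)) p :=
  AnalyticAt.fun_comp (g := shiftMap (m := m)) (f := fun p => (recip a p, amp p))
    (analyticAt_shiftMap (recip_ne_zero hm hp) (params_of_mem_U hm hp).c_lt)
    ((analyticAt_recip hp.1).prod (analyticAt_amp hp))

theorem analyticOn_shift (hm : 0 < m) : AnalyticOn ℝ (shift a m) (U a m) := by
  have h : AnalyticOn ℝ (fun p => (shiftMap (recip a p, amp p) : Fin m → ℝ)) (U a m) :=
    fun p hp => (((hyperplane m).subtypeL.analyticAt _).comp
      (analyticAt_shift_extension hm hp)).analyticWithinAt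
  exact h.congr fun p hp => shift_eq_shiftMap hm hp

theorem mapsTo_shift (hm : 0 < m) : MapsTo (shift a m) (U a m) (V a m) := by
  intro p hp
  have P := params_of_mem_U hm hp
  have h : ∀ j, ∃ I > 0, shift a m p j = -(sgn a j * I) := by
    intro j
    obtain ⟨I, hI, h⟩ := exists_shiftVec_eq_neg_mul P.sum_y P.y_ne P.c_lt j
    refine ⟨I / p.1 j, div_pos hI (hp.1 j), ?_⟩
    rw [shift_eq hm hp, h, P.y_eq]
    ring
  refine ⟨fun j hj => ?_, fun j hj => ?_, ?_⟩
  · obtain ⟨I, hI, h⟩ := h j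
    rw [h, sgn, if_pos hj]; linarith
  · obtain ⟨I, hI, h⟩ := h j
    rw [h, sgn, if_neg (not_lt.2 hj)]; linarith
  · rw [shift_eq hm hp]
    exact sum_shiftVec P.sum_y P.y_ne P.c_lt

end Parameters

/-! ### The case m = 2 -/

section Two

/-- The half-angle primitive is rewritten with k = c/(1 + √(1 - c²)). As |k| < 1, the arctangent
term is smooth and 2π-periodic on the whole line, and only the linear term contributes. -/
theorem integral_inv_one_add_mul_sin {c : ℝ} (hc : |c| < 1) :
    ∫ s in (0 : ℝ)..2 * Real.pi, 1 / (1 + c * Real.sin s) = 2 * Real.pi / √(1 - c ^ 2) := by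
  set d := √(1 - c ^ 2) with hd
  have hd0 : 0 < d := Real.sqrt_pos.2 (one_sub_sq_pos hc)
  have hd2 : d ^ 2 = 1 - c ^ 2 := Real.sq_sqrt (one_sub_sq_pos hc).le
  set k := c / (1 + d) with hk
  have hk1 : |k| < 1 := by
    rw [hk, abs_div, abs_of_pos (by linarith : 0 < 1 + d), div_lt_one (by linarith)]
    linarith
  have hkd : k * (1 + d) = c := by rw [hk]; field_simp
  have hk2 : 1 - k ^ 2 = d * (1 + k ^ 2) := by
    have h1 : k ^ 2 * (1 + d) ^ 2 = c ^ 2 := by rw [← mul_pow, hkd]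
    have h2 : (1 + d) * (1 - k ^ 2 - d * (1 + k ^ 2)) = 0 := by linear_combination -h1 - hd2
    have h3 := (mul_eq_zero.1 h2).resolve_left (by positivity)
    linarith
  have hck : c * (1 + k ^ 2) = 2 * k := by
    rw [← hkd]; linear_combination -k * hk2
  have hpos : ∀ {c : ℝ}, |c| < 1 → ∀ s, 0 < 1 + c * Real.sin s := fun hc s => by
    have := (abs_lt.1 (abs_mul_sin_lt hc s)).1
    linarith
  have hF : ∀ s ∈ uIcc 0 (2 * Real.pi), HasDerivAt (fun s => (s + 2 * Real.arctan
      (k * Real.cos s / (1 + k * Real.sin s))) / d) (1 / (1 + c * Real.sin s)) s := by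
    intro s _
    have h1 := hpos hk1 s
    have h2 := hpos hc s
    have h3 := ((hasDerivAt_id s).add (((((Real.hasDerivAt_cos s).const_mul k).div
      (((Real.hasDerivAt_sin s).const_mul k).const_add 1) h1.ne').arctan).const_mul 2)).div_const d
    refine h3.congr_deriv ?_
    have hsc := Real.sin_sq_add_cos_sq s
    have h5 : 1 + (k * Real.cos s / (1 + k * Real.sin s)) ^ 2
        = (1 + k ^ 2) * (1 + c * Real.sin s) / (1 + k * Real.sin s) ^ 2 := by
      field_simp
      linear_combination k ^ 2 * hsc - Real.sin s * hck
    simp only [Pi.div_apply]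
    rw [h5]
    have h6 : 0 < 1 + k ^ 2 := by positivity
    field_simp
    linear_combination (-2 * k ^ 2) * hsc + Real.sin s * hck + hk2
  rw [intervalIntegral.integral_eq_sub_of_hasDerivAt hF]
  · simp only [Real.cos_two_pi, Real.sin_two_pi, Real.cos_zero, Real.sin_zero]
    ring
  · refine (Continuous.intervalIntegrable ?_ _ _)
    exact continuous_const.div (by fun_prop) fun s => (hpos hc s).ne'

/-- Here the product is 1 - y_0² u², so x = y_0 u and the density is 1/(1 + x). -/
theorem shiftVec_two {y : Fin 2 → ℝ} (hs : ∑ j, y j = 0) (h0 : 0 < y 0) {c : ℝ} (hc : |c| < 1) :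
    shiftVec y c 0 = -Real.pi := by
  have hy : y ≠ 0 := fun h => h0.ne' (by rw [h]; rfl)
  have h1 : y 1 = -y 0 := by
    rw [Fin.sum_univ_two] at hs; linarith
  have hR : ∀ u, remainder (y, u) = y 0 ^ 2 := fun u => by
    by_cases hu : u = 0
    · rw [hu, remainder_zero hs, Fin.sum_univ_two, h1]; ring
    · have := prod_eq_remainder hs u
      rw [Fin.prod_univ_two, h1] at this
      have h2 : u ^ 2 ≠ 0 := by positivity
      apply mul_left_cancel₀ h2
      linear_combination this
  have hk : ∀ x, |x| < 1 → kern y 0 x = 1 / (1 + x) := fun x hx => by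
    have hmor := morse_invMorse hs hy hx
    have hmem := invMorse_mem hs hy hx
    rw [morse, hR, Real.sqrt_sq h0.le] at hmor
    have hx1 : 1 + x ≠ 0 := by have := (abs_lt.1 hx).1; linarith
    have hx2 : 1 - x ≠ 0 := by have := (abs_lt.1 hx).2; linarith
    have hx3 : 1 - x ^ 2 ≠ 0 := (one_sub_sq_pos hx).ne'
    have hyu : y 0 * invMorse y x = x := by rw [mul_comm]; exact hmor
    have hcurv : curv y (invMorse y x) = 2 * y 0 ^ 2 / (1 - x ^ 2) := by
      rw [curv, Fin.sum_univ_two, h1, neg_mul, hyu, ← sub_eq_add_neg]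
      field_simp
      ring
    rw [kern, dInvMorse, hcurv, hR, Real.sqrt_sq h0.le, hyu]
    have := h0.ne'
    field_simp
  have hd0 : 0 < √(1 - c ^ 2) := Real.sqrt_pos.2 (one_sub_sq_pos hc)
  simp only [shiftVec, hk _ (abs_mul_sin_lt hc _), integral_inv_one_add_mul_sin hc]
  field_simp

theorem shift_two {p : (Fin 2 → ℝ) × ℝ} (hp : p ∈ U 1 2) (j : Fin 2) :
    shift 1 2 p j = if (j : ℕ) < 1 then -Real.pi else Real.pi := by
  have P := params_of_mem_U two_pos hp
  have h0 : shiftVec (recip 1 p : Fin 2 → ℝ) (amp p) 0 = -Real.pi :=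
    shiftVec_two P.sum_y (by
      rw [P.y_eq]
      exact div_pos (by simp [sgn]) (hp.1 0)) P.c_lt
  have h1 := sum_shiftVec P.sum_y P.y_ne P.c_lt
  rw [Fin.sum_univ_two, h0] at h1
  rw [shift_eq two_pos hp]
  fin_cases j
  · simpa using h0
  · simp only [Fin.mk_one, Fin.isValue]
    norm_num
    linarith

end Two

/-! ### Two-valued vectors: the shift is radial and its length is not constant in c -/

section TwoValued

/-- A balanced vector taking only the two values `p` and `-r`, normalized so that its squared
length is `p + r`. -/
structure TwoValued {m : ℕ} (y : Fin m → ℝ) (p r : ℝ) : Prop where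
  sum_y : ∑ j, y j = 0
  val : ∀ j, y j = p ∨ y j = -r
  p_mem : ∃ j, y j = p
  r_mem : ∃ j, y j = -r
  sum_sq : ∑ j, y j ^ 2 = p + r
  p_pos : 0 < p
  r_pos : 0 < r
  p_le : p ≤ 1
  r_le : r ≤ 1
  add_lt : p + r < 2

variable {m : ℕ} {y : Fin m → ℝ} {p r : ℝ}

namespace TwoValued

theorem neg (h : TwoValued y p r) : TwoValued (-y) r p where
  sum_y := by simp [h.sum_y]
  val j := by rcases h.val j with h | h <;> simp [h]
  p_mem := by obtain ⟨j, hj⟩ := h.r_mem; exact ⟨j, by simp [hj]⟩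
  r_mem := by obtain ⟨j, hj⟩ := h.p_mem; exact ⟨j, by simp [hj]⟩
  sum_sq := by simpa [add_comm] using h.sum_sq
  p_pos := h.r_pos
  r_pos := h.p_pos
  p_le := h.r_le
  r_le := h.p_le
  add_lt := by linarith [h.add_lt]

variable (h : TwoValued y p r)

include h

theorem y_ne : y ≠ 0 := by
  obtain ⟨j, hj⟩ := h.p_mem
  intro hy
  have := h.p_pos
  rw [hy] at hj
  simp only [Pi.zero_apply] at hj
  linarith

theorem factors_pos {u : ℝ} (hu : u ∈ dom y) : 0 < 1 + p * u ∧ 0 < 1 - r * u := by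
  obtain ⟨j, hj⟩ := h.p_mem
  obtain ⟨k, hk⟩ := h.r_mem
  have h1 := hu j
  have h2 := hu k
  rw [hj] at h1
  rw [hk] at h2
  exact ⟨h1, by linarith⟩

/-- Each denominator 1 + y_j u is one of the two factors, so every summand becomes affine in u, and
the sums of y_j and y_j² are known. -/
theorem curv_mul {u : ℝ} (hu : u ∈ dom y) : curv y u * ((1 + p * u) * (1 - r * u)) = p + r := by
  have h1 : ∀ j, y j ^ 2 / (1 + y j * u) * ((1 + p * u) * (1 - r * u))
      = y j ^ 2 - p * r * u * y j := fun j => by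
    have := (hu j).ne'
    rw [div_mul_eq_mul_div, div_eq_iff this]
    rcases h.val j with hj | hj <;> rw [hj] <;> ring
  rw [curv, Finset.sum_mul]
  simp only [h1, Finset.sum_sub_distrib, ← Finset.mul_sum, h.sum_y, h.sum_sq]
  ring

/-- The inequality between the logarithmic derivatives of `∏ (1 + y_j u)` and of its comparison
function `1 - (p + r) / 2 * (u / (1 - (r - p) / 3 * u)) ^ 2`. -/
theorem cubic_lt {v : ℝ} (hv : 0 < v) (hrv : 0 < 1 - r * v) :
    (1 - (r - p) / 3 * v) * ((1 - (r - p) / 3 * v) ^ 2 - (p + r) / 2 * v ^ 2)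
      < (1 + p * v) * (1 - r * v) := by
  have hp := h.p_pos
  have hr := h.r_pos
  have hp1 := h.p_le
  have hr1 := h.r_le
  have hlt := h.add_lt
  set δ := (r - p) / 3 with hδ
  -- The difference of the two sides is v² (K₀ + K₁ v). The affine factor is positive on (0, 1/r)
  -- because it is positive at both ends, which is K₀ > 0 and r K₀ + K₁ > 0.
  set K₀ := (p + r) / 2 - p * r - 3 * δ ^ 2 with hK₀
  set K₁ := δ * (δ ^ 2 - (p + r) / 2) with hK₁
  -- Strictness comes from here: for p = r = 1, the case m = 2, the two sides coincide.
  have hor : p < 1 ∨ r < 1 := by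
    by_contra! hh
    linarith [hh.1, hh.2]
  have h1 : 0 < K₀ := by
    have h2 : K₀ = (p * (1 - r) + r * (1 - p)) / 2 - (r - p) ^ 2 / 3 := by
      rw [hK₀, hδ]; ring
    have h3 : (r - p) ^ 2 ≤ p * (1 - r) + r * (1 - p) := by nlinarith
    have h4 : 0 < p * (1 - r) + r * (1 - p) := by
      rcases hor with h5 | h5
      · have := mul_pos hr (sub_pos.2 h5)
        have := mul_nonneg hp.le (sub_nonneg.2 hr1)
        linarith
      · have := mul_pos hp (sub_pos.2 h5)
        have := mul_nonneg hr.le (sub_nonneg.2 hp1)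
        linarith
    rw [h2]; linarith
  have h2 : 0 < r * K₀ + K₁ := by
    have h3 : r * K₀ + K₁ = (2 * r + p) / 3 * ((p + r) / 2 - (2 * r + p) ^ 2 / 9) := by
      rw [hK₀, hK₁, hδ]; ring
    rw [h3]
    refine mul_pos (by positivity) ?_
    have e1 := mul_nonneg hr.le (sub_nonneg.2 hr1)
    have e2 := mul_nonneg hp.le (sub_nonneg.2 hp1)
    have e3 := mul_nonneg hr.le (sub_nonneg.2 hp1)
    have e4 := mul_nonneg hp.le (sub_nonneg.2 hr1)
    have e5 : 0 < r * (1 - r) ∨ 0 < p * (1 - p) := by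
      rcases hor with h5 | h5
      · exact Or.inr (mul_pos hp (sub_pos.2 h5))
      · exact Or.inl (mul_pos hr (sub_pos.2 h5))
    rcases e5 with e5 | e5 <;> nlinarith
  have h3 : 0 < (1 - r * v) * K₀ + v * (r * K₀ + K₁) := by positivity
  have h4 : 0 < v ^ 2 * ((1 - r * v) * K₀ + v * (r * K₀ + K₁)) := by positivity
  have h5 : (1 + p * v) * (1 - r * v) - (1 - δ * v) * ((1 - δ * v) ^ 2 - (p + r) / 2 * v ^ 2)
      = v ^ 2 * ((1 - r * v) * K₀ + v * (r * K₀ + K₁)) := by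
    have h6 : r - p = 3 * δ := by rw [hδ]; ring
    rw [hK₀, hK₁]
    linear_combination (-v) * h6
  linarith

theorem one_sub_pos {v : ℝ} (hv : 0 ≤ v) (hrv : 0 < 1 - r * v) : 0 < 1 - (r - p) / 3 * v := by
  have := mul_nonneg h.p_pos.le hv
  nlinarith

/-- The value δ = (r - p)/3 makes the two sides agree through third order at u = 0. Their quotient
starts at 1 and increases, which is `cubic_lt` after inserting the closed form of `curv`. -/
theorem prod_gt_of_pos {u : ℝ} (hu : u ∈ dom y) (hu0 : 0 < u) :
    1 - (p + r) / 2 * u ^ 2 / (1 - (r - p) / 3 * u) ^ 2 < ∏ j, (1 + y j * u) := by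
  set δ := (r - p) / 3 with hδ
  set κ := (p + r) / 2 with hκ
  have hκ0 : 0 < κ := by have := h.p_pos; have := h.r_pos; positivity
  set w : ℝ → ℝ := fun v => 1 - κ * v ^ 2 / (1 - δ * v) ^ 2 with hw
  change w u < _
  rcases le_or_gt (w u) 0 with h0 | h0
  · exact h0.trans_lt (prod_pos_of_mem hu)
  have hmem : ∀ v ∈ Icc 0 u, v ∈ dom y := fun v hv =>
    (convex_dom y).ordConnected.out (zero_mem_dom y) hu hv
  have hδpos : ∀ v ∈ Icc 0 u, 0 < 1 - δ * v := fun v hv =>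
    h.one_sub_pos hv.1 (h.factors_pos (hmem v hv)).2
  have hwiff : ∀ v ∈ Icc 0 u, 0 < w v ↔ √κ * v < 1 - δ * v := fun v hv => by
    have h1 := hδpos v hv
    rw [hw, sub_pos, div_lt_one (by positivity), ← Real.sq_sqrt hκ0.le, ← mul_pow,
      pow_lt_pow_iff_left₀ (mul_nonneg (Real.sqrt_nonneg _) hv.1) h1.le two_ne_zero,
      Real.sq_sqrt hκ0.le]
  -- Positivity of w means √κ v < 1 - δ v, an affine condition that holds at 0 and at u.
  have hwpos : ∀ v ∈ Icc 0 u, 0 < w v := fun v hv => by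
    rw [hwiff v hv]
    have h1 := (hwiff u ⟨hu0.le, le_rfl⟩).1 h0
    rcases le_or_gt (√κ + δ) 0 with h2 | h2
    · nlinarith [mul_nonneg (neg_nonneg.2 h2) hv.1]
    · nlinarith [mul_le_mul_of_nonneg_left hv.2 h2.le]
  have hwd : ∀ v ∈ Icc 0 u, HasDerivAt w (-(2 * κ * v / (1 - δ * v) ^ 3)) v := fun v hv => by
    have h1 := (hδpos v hv).ne'
    have h2 : HasDerivAt (fun v => 1 - δ * v) (-δ) v := by
      simpa using ((hasDerivAt_id v).const_mul δ).const_sub 1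
    have h3 := ((((hasDerivAt_pow 2 v).const_mul κ).div (h2.fun_pow 2)
      (pow_ne_zero 2 h1))).const_sub 1
    refine h3.congr_deriv ?_
    field_simp
    ring
  have hEd : ∀ v ∈ Icc 0 u, HasDerivAt (fun v => (∏ j, (1 + y j * v)) / w v)
      ((∏ j, (1 + y j * v)) * v / w v ^ 2 *
        (2 * κ / (1 - δ * v) ^ 3 - curv y v * w v)) v := fun v hv => by
    refine ((hasDerivAt_prod h.sum_y (hmem v hv)).div (hwd v hv) (hwpos v hv).ne').congr_deriv ?_
    ring
  have hmono : StrictMonoOn (fun v => (∏ j, (1 + y j * v)) / w v) (Icc 0 u) := by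
    refine strictMonoOn_of_deriv_pos (convex_Icc 0 u)
      (fun v hv => (hEd v hv).continuousAt.continuousWithinAt) fun v hv => ?_
    rw [interior_Icc] at hv
    have hv' := Ioo_subset_Icc_self hv
    rw [(hEd v hv').deriv]
    have h1 := hwpos v hv'
    have h2 := prod_pos_of_mem (hmem v hv')
    have h3 := hδpos v hv'
    obtain ⟨h4, h5⟩ := h.factors_pos (hmem v hv')
    have hv0 := hv.1
    refine mul_pos (by positivity) ?_
    have h6 := h.cubic_lt hv0 h5
    have h7 : curv y v = 2 * κ / ((1 + p * v) * (1 - r * v)) := by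
      rw [eq_div_iff (by positivity), h.curv_mul (hmem v hv'), hκ]; ring
    have h8 : (1 - δ * v) ^ 3 * w v = (1 - δ * v) * ((1 - δ * v) ^ 2 - κ * v ^ 2) := by
      simp only [hw]; field_simp
    have h9 : (1 - δ * v) ^ 3 * w v < (1 + p * v) * (1 - r * v) := by rw [h8]; exact h6
    rw [h7, sub_pos, div_mul_eq_mul_div, div_lt_div_iff₀ (by positivity) (by positivity)]
    have h10 : 0 < 2 * κ := by positivity
    nlinarith [mul_lt_mul_of_pos_left h9 h10]
  have hfin := hmono (left_mem_Icc.2 hu0.le) (right_mem_Icc.2 hu0.le) hu0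
  have hw0 : w 0 = 1 := by simp [hw]
  simp only [mul_zero, add_zero, Finset.prod_const_one, hw0, div_one] at hfin
  rwa [one_lt_div h0] at hfin

/-- Since x = u √R, this says √R < √κ + δ x with δ = (r - p)/3 and κ = (p + r)/2. The term δ x will
integrate to zero, so a bound on the average by the value at c = 0 remains. -/
theorem sqrt_remainder_lt_of_pos {u : ℝ} (hu : u ∈ dom y) (hu0 : 0 < u) :
    √(remainder (y, u)) * (1 - (r - p) / 3 * u) < √((p + r) / 2) := by
  have h1 := h.prod_gt_of_pos hu hu0
  have h2 := h.one_sub_pos hu0.le (h.factors_pos hu).2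
  rw [prod_eq_remainder h.sum_y] at h1
  have h3 : u ^ 2 * remainder (y, u) < u ^ 2 * ((p + r) / 2 / (1 - (r - p) / 3 * u) ^ 2) := by
    have : (p + r) / 2 * u ^ 2 / (1 - (r - p) / 3 * u) ^ 2
      = u ^ 2 * ((p + r) / 2 / (1 - (r - p) / 3 * u) ^ 2) := by ring
    linarith
  have h4 := lt_of_mul_lt_mul_left h3 (sq_nonneg u)
  rw [lt_div_iff₀ (by positivity)] at h4
  have h5 := Real.sqrt_lt_sqrt (mul_nonneg (remainder_pos h.sum_y h.y_ne hu).le (sq_nonneg _)) h4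
  rwa [Real.sqrt_mul (remainder_pos h.sum_y h.y_ne hu).le, Real.sqrt_sq h2.le] at h5

theorem sqrt_remainder_lt {u : ℝ} (hu : u ∈ dom y) (hu0 : u ≠ 0) :
    √(remainder (y, u)) * (1 - (r - p) / 3 * u) < √((p + r) / 2) := by
  rcases hu0.lt_or_gt with h0 | h0
  · have hu' : -u ∈ dom (-y) := neg_mem_dom (by simpa using hu)
    have h1 := h.neg.sqrt_remainder_lt_of_pos hu' (neg_pos.2 h0)
    have h2 : remainder (-y, -u) = remainder (y, u) := by
      have h3 := prod_eq_remainder h.sum_y u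
      have h4 := prod_eq_remainder h.neg.sum_y (-u)
      simp only [Pi.neg_apply, neg_mul_neg] at h4
      have h5 : u ^ 2 ≠ 0 := by positivity
      apply mul_left_cancel₀ h5
      linear_combination h4 - h3
    rw [h2, add_comm r p] at h1
    convert h1 using 2
    ring
  · exact h.sqrt_remainder_lt_of_pos hu h0

theorem sqrt_remainder_zero : √(remainder (y, 0)) = √((p + r) / 2) := by
  rw [remainder_zero h.sum_y, h.sum_sq]

/-- Dividing (1 + p u)(1 - r u) by 1 + y_j u leaves the other factor, affine in u; with u √R = x its
linear part gives an odd function of x. What survives integration is y_j times a factor independent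
of j, so the shift is radial. -/
theorem kern_eq {x : ℝ} (hx : |x| < 1) (j : Fin m) :
    kern y j x = y j / ((p + r) / 2) * (√(remainder (y, invMorse y x)) / (1 - x ^ 2))
      + -(y j * (y j - p + r) / ((p + r) / 2)) * (x / (1 - x ^ 2)) := by
  have hm := invMorse_mem h.sum_y h.y_ne hx
  have hmor : invMorse y x * √(remainder (y, invMorse y x)) = x :=
    morse_invMorse h.sum_y h.y_ne hx
  have h0 := (one_sub_sq_pos hx).ne'
  have h1 := h.curv_mul hm
  have hpr : p + r ≠ 0 := by have := h.p_pos; have := h.r_pos; positivity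
  obtain ⟨h2, h3⟩ := h.factors_pos hm
  rw [kern, dInvMorse]
  set u := invMorse y x
  set R := √(remainder (y, u))
  have h4 : curv y u = (p + r) / ((1 + p * u) * (1 - r * u)) := by
    rw [eq_div_iff (by positivity), h1]
  have h5 : (1 + p * u) * (1 - r * u) / (1 + y j * u) = 1 - (y j - p + r) * u := by
    have := (hm j).ne'
    rw [div_eq_iff this]
    rcases h.val j with hj | hj <;> rw [hj] <;> ring
  have h6 : y j * (2 * R / ((1 - x ^ 2) * curv y u)) / (1 + y j * u)
      = y j * (2 * R / ((1 - x ^ 2) * (p + r))) * ((1 + p * u) * (1 - r * u) / (1 + y j * u)) := by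
    rw [h4]
    field_simp
  rw [h6, h5]
  field_simp
  linear_combination (-(y j * (y j - p + r))) * hmor

/-- The radial factor of the period shift at a two-valued vector. -/
theorem exists_factor {c : ℝ} (hc : |c| < 1) : ∃ g : ℝ, shiftVec y c = -g • y ∧
    (c ≠ 0 → g < Real.pi / √((p + r) / 2)) ∧ (c = 0 → g = Real.pi / √((p + r) / 2)) := by
  set κ := (p + r) / 2 with hκ
  have hκ0 : 0 < κ := by have := h.p_pos; have := h.r_pos; positivity
  set F : ℝ → ℝ := fun x => √(remainder (y, invMorse y x)) / (1 - x ^ 2) with hF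
  have hFc : ∀ x, |x| < 1 → ContinuousAt F x := fun x hx => by
    refine ContinuousAt.div (ContinuousAt.sqrt ?_) (by fun_prop) (one_sub_sq_pos hx).ne'
    exact ContinuousAt.comp (f := invMorse y)
      (differentiableAt_remainder y _).continuousAt
      (hasDerivAt_invMorse h.sum_y h.y_ne hx).continuousAt
  have hFs := continuous_comp_mul_sin hFc hc
  have hGs : Continuous fun s => (c * Real.sin s) / (1 - (c * Real.sin s) ^ 2) :=
    continuous_comp_mul_sin (f := fun x => x / (1 - x ^ 2))
      (fun x hx => ContinuousAt.div (by fun_prop) (by fun_prop) (one_sub_sq_pos hx).ne') hc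
  have hIs : Continuous fun s => 1 / (1 - (c * Real.sin s) ^ 2) :=
    continuous_comp_mul_sin (f := fun x => 1 / (1 - x ^ 2))
      (fun x hx => ContinuousAt.div (by fun_prop) (by fun_prop) (one_sub_sq_pos hx).ne') hc
  have hG0 : ∫ s in (0 : ℝ)..2 * Real.pi, (c * Real.sin s) / (1 - (c * Real.sin s) ^ 2) = 0 :=
    integral_odd_comp_sin (f := fun x => x / (1 - x ^ 2)) (fun x => by ring) c
  have hd := Real.sqrt_pos.2 (one_sub_sq_pos hc)
  -- Partial fractions reduce this to the integral of 1/(1 ± c sin s). The result cancels the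
  -- prefactor √(1 - c²), so the upper bound for g does not depend on c.
  have hI : ∫ s in (0 : ℝ)..2 * Real.pi, 1 / (1 - (c * Real.sin s) ^ 2)
      = 2 * Real.pi / √(1 - c ^ 2) := by
    have hpos : ∀ {c : ℝ}, |c| < 1 → ∀ s, 0 < 1 + c * Real.sin s := fun hc s => by
      have := (abs_lt.1 (abs_mul_sin_lt hc s)).1
      linarith
    have hc' : |-c| < 1 := by rwa [abs_neg]
    have hcont : ∀ {c : ℝ}, |c| < 1 → Continuous fun s => 1 / (1 + c * Real.sin s) := fun hc =>
      continuous_const.div (by fun_prop) fun s => (hpos hc s).ne'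
    have e1 : ∀ s, 1 / (1 - (c * Real.sin s) ^ 2)
        = 1 / 2 * (1 / (1 + c * Real.sin s) + 1 / (1 + -c * Real.sin s)) := fun s => by
      have a1 := (hpos hc s).ne'
      have a2 : 1 - c * Real.sin s ≠ 0 := by
        have := (hpos hc' s).ne'
        rwa [neg_mul, ← sub_eq_add_neg] at this
      have a3 : 1 - (c * Real.sin s) ^ 2 = (1 + c * Real.sin s) * (1 - c * Real.sin s) := by ring
      rw [a3, neg_mul, ← sub_eq_add_neg]
      field_simp
      ring
    simp only [e1]
    rw [intervalIntegral.integral_const_mul, intervalIntegral.integral_add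
      ((hcont hc).intervalIntegrable _ _) ((hcont hc').intervalIntegrable _ _),
      integral_inv_one_add_mul_sin hc, integral_inv_one_add_mul_sin hc', neg_sq]
    ring
  refine ⟨√(1 - c ^ 2) / 2 / κ * ∫ s in (0 : ℝ)..2 * Real.pi, F (c * Real.sin s), ?_, ?_, ?_⟩
  · funext j
    simp only [shiftVec, h.kern_eq (abs_mul_sin_lt hc _)]
    rw [intervalIntegral.integral_add ((hFs.const_mul _).intervalIntegrable _ _)
      ((hGs.const_mul _).intervalIntegrable _ _), intervalIntegral.integral_const_mul,
      intervalIntegral.integral_const_mul, hG0]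
    simp only [Pi.smul_apply, smul_eq_mul, hF]
    ring
  · intro hc0
    have hle : ∀ x, |x| < 1 → F x ≤ √κ * (1 / (1 - x ^ 2)) + (r - p) / 3 * (x / (1 - x ^ 2)) ∧
        (x ≠ 0 → F x < √κ * (1 / (1 - x ^ 2)) + (r - p) / 3 * (x / (1 - x ^ 2))) := by
      intro x hx
      have h0 := one_sub_sq_pos hx
      have e1 : √κ * (1 / (1 - x ^ 2)) + (r - p) / 3 * (x / (1 - x ^ 2))
          = (√κ + (r - p) / 3 * x) / (1 - x ^ 2) := by ring
      have e2 : x ≠ 0 → F x < √κ * (1 / (1 - x ^ 2)) + (r - p) / 3 * (x / (1 - x ^ 2)) := by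
        intro hx0
        rw [e1, hF]
        refine div_lt_div_of_pos_right ?_ h0
        have hm := invMorse_mem h.sum_y h.y_ne hx
        have hmor : invMorse y x * √(remainder (y, invMorse y x)) = x :=
          morse_invMorse h.sum_y h.y_ne hx
        have hu0 : invMorse y x ≠ 0 := fun hh => hx0 (by rw [← hmor, hh, zero_mul])
        have e3 := h.sqrt_remainder_lt hm hu0
        have e4 : (r - p) / 3 * x
            = √(remainder (y, invMorse y x)) * ((r - p) / 3 * invMorse y x) := by
          linear_combination (-((r - p) / 3)) * hmor
        rw [e4]
        linarith
      refine ⟨?_, e2⟩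
      by_cases hx0 : x = 0
      · subst hx0
        simp only [hF, invMorse_zero h.sum_y h.y_ne, h.sqrt_remainder_zero]
        simp [hκ]
      · exact (e2 hx0).le
    have hlt : ∫ s in (0 : ℝ)..2 * Real.pi, F (c * Real.sin s) < √κ * (2 * Real.pi / √(1 - c ^ 2)) := by
      have hHs : Continuous fun s => √κ * (1 / (1 - (c * Real.sin s) ^ 2))
          + (r - p) / 3 * ((c * Real.sin s) / (1 - (c * Real.sin s) ^ 2)) :=
        (hIs.const_mul _).add (hGs.const_mul _)
      have e1 : ∫ s in (0 : ℝ)..2 * Real.pi, (√κ * (1 / (1 - (c * Real.sin s) ^ 2))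
          + (r - p) / 3 * ((c * Real.sin s) / (1 - (c * Real.sin s) ^ 2)))
          = √κ * (2 * Real.pi / √(1 - c ^ 2)) := by
        rw [intervalIntegral.integral_add ((hIs.const_mul _).intervalIntegrable _ _)
          ((hGs.const_mul _).intervalIntegrable _ _), intervalIntegral.integral_const_mul,
          intervalIntegral.integral_const_mul, hG0, hI, mul_zero, add_zero]
      rw [← e1]
      refine intervalIntegral.integral_lt_integral_of_continuousOn_of_le_of_exists_lt
        Real.two_pi_pos hFs.continuousOn hHs.continuousOn
        (fun s _ => (hle _ (abs_mul_sin_lt hc s)).1)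
        ⟨Real.pi / 2, ⟨by positivity, by linarith [Real.pi_pos]⟩, ?_⟩
      refine (hle _ (abs_mul_sin_lt hc _)).2 ?_
      simpa using hc0
    have e2 : √(1 - c ^ 2) / 2 / κ * (√κ * (2 * Real.pi / √(1 - c ^ 2))) = Real.pi / √κ := by
      have e3 := Real.sqrt_pos.2 hκ0
      nth_rewrite 1 [← Real.mul_self_sqrt hκ0.le]
      field_simp
    rw [← e2]
    exact mul_lt_mul_of_pos_left hlt (by positivity)
  · intro hc0
    subst hc0
    have e3 := Real.sqrt_pos.2 hκ0
    simp only [hF, zero_mul, invMorse_zero h.sum_y h.y_ne, h.sqrt_remainder_zero, ← hκ,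
      intervalIntegral.integral_const, smul_eq_mul, sub_zero, ne_eq, OfNat.ofNat_ne_zero,
      not_false_eq_true, zero_pow, Real.sqrt_one, div_one]
    nth_rewrite 1 [← Real.mul_self_sqrt hκ0.le]
    field_simp

end TwoValued

/-- The vector with entries `1 / a` and `-1 / (m - a)`. -/
noncomputable def refVec (a m : ℕ) (j : Fin m) : ℝ :=
  if (j : ℕ) < a then (a : ℝ)⁻¹ else -((m - a : ℕ) : ℝ)⁻¹

theorem card_filter_lt {a m : ℕ} (ham : a ≤ m) :
    (Finset.univ.filter fun j : Fin m => (j : ℕ) < a).card = a := by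
  simpa [Nat.min_eq_right ham] using Fin.card_filter_val_lt (n := m) (m := a)

theorem card_filter_not_lt {a m : ℕ} (ham : a ≤ m) :
    (Finset.univ.filter fun j : Fin m => ¬ (j : ℕ) < a).card = m - a := by
  have := Finset.card_filter_add_card_filter_not (s := (Finset.univ : Finset (Fin m)))
    (fun j : Fin m => (j : ℕ) < a)
  rw [card_filter_lt ham] at this
  simp only [Finset.card_univ, Fintype.card_fin] at this
  omega

theorem twoValued_refVec {a m : ℕ} (ha : 1 ≤ a) (ham : a < m) (hm : 3 ≤ m) :
    TwoValued (refVec a m) (a : ℝ)⁻¹ ((m - a : ℕ) : ℝ)⁻¹ := by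
  have ha0 : (0 : ℝ) < a := by exact_mod_cast ha
  have hb : 1 ≤ m - a := by omega
  have hb0 : (0 : ℝ) < (m - a : ℕ) := by exact_mod_cast hb
  have hsum : ∀ f : ℝ → ℝ, ∑ j, f (refVec a m j)
      = a * f (a : ℝ)⁻¹ + (m - a : ℕ) * f (-((m - a : ℕ) : ℝ)⁻¹) := fun f => by
    simp only [refVec, apply_ite f, Finset.sum_ite, Finset.sum_const, card_filter_lt ham.le,
      card_filter_not_lt ham.le, nsmul_eq_mul]
  refine ⟨?_, fun j => ?_, ⟨⟨0, by omega⟩, ?_⟩, ⟨⟨a, ham⟩, ?_⟩, ?_, by positivity, by positivity,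
    ?_, ?_, ?_⟩
  · rw [hsum fun x => x]
    field_simp
    norm_num
  · unfold refVec; split_ifs <;> simp
  · rw [refVec, if_pos (show 0 < a by omega)]
  · rw [refVec, if_neg (by simp)]
  · rw [hsum fun x => x ^ 2]
    field_simp
  · exact inv_le_one_of_one_le₀ (by exact_mod_cast ha)
  · exact inv_le_one_of_one_le₀ (by exact_mod_cast hb)
  · have h1 : (a : ℝ)⁻¹ ≤ 1 := inv_le_one_of_one_le₀ (by exact_mod_cast ha)
    have h2 : ((m - a : ℕ) : ℝ)⁻¹ ≤ 1 := inv_le_one_of_one_le₀ (by exact_mod_cast hb)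
    rcases (by omega : 2 ≤ a ∨ 2 ≤ m - a) with h | h
    · have : (a : ℝ)⁻¹ < 1 := inv_lt_one_of_one_lt₀ (by exact_mod_cast h)
      linarith
    · have : ((m - a : ℕ) : ℝ)⁻¹ < 1 := inv_lt_one_of_one_lt₀ (by exact_mod_cast h)
      linarith

end TwoValued

/-! ### Determinants and invertibility of operator families -/

theorem analyticAt_det {E F : Type*} [NormedAddCommGroup E] [NormedSpace ℝ E]
    [NormedAddCommGroup F] [NormedSpace ℝ F] [FiniteDimensional ℝ F] {f : E → F →L[ℝ] F} {x : E}
    (hf : AnalyticAt ℝ f x) : AnalyticAt ℝ (fun x => LinearMap.det (f x : F →ₗ[ℝ] F)) x := by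
  let b := Module.finBasis ℝ F
  have h1 : (fun x => LinearMap.det (f x : F →ₗ[ℝ] F)) = fun x =>
      ∑ σ : Equiv.Perm (Fin (Module.finrank ℝ F)), ((Equiv.Perm.sign σ : ℤ) : ℝ) *
        ∏ i, b.coord (σ i) (f x (b i)) := by
    funext x
    rw [← LinearMap.det_toMatrix b, Matrix.det_apply']
    simp [LinearMap.toMatrix_apply]
  rw [h1]
  refine Finset.analyticAt_fun_sum _ fun σ _ => analyticAt_const.mul
    (Finset.analyticAt_fun_prod _ fun i _ => ?_)
  exact (((LinearMap.toContinuousLinearMap (b.coord (σ i))).comp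
    (ContinuousLinearMap.apply ℝ F (b i))).analyticAt _).comp hf

theorem analyticAt_comp_const {X E F G : Type*} [NormedAddCommGroup X] [NormedSpace ℝ X]
    [NormedAddCommGroup E] [NormedSpace ℝ E] [NormedAddCommGroup F] [NormedSpace ℝ F]
    [NormedAddCommGroup G] [NormedSpace ℝ G] {f : X → F →L[ℝ] G} {x : X}
    (hf : AnalyticAt ℝ f x) (σ : E →L[ℝ] F) : AnalyticAt ℝ (fun x => (f x).comp σ) x :=
  (((ContinuousLinearMap.compL ℝ E F G).flip σ).analyticAt _).comp hf

theorem eventually_isUnit {X E : Type*} [TopologicalSpace X] [NormedAddCommGroup E]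
    [NormedSpace ℝ E] [CompleteSpace E] {f : X → E →L[ℝ] E} {x : X} (hf : ContinuousAt f x)
    (h : IsUnit (f x)) : ∀ᶠ x' in 𝓝 x, IsUnit (f x') :=
  hf.preimage_mem_nhds (Units.isOpen.mem_nhds h)

/-! ### A point where the derivative is surjective -/

section GoodPoint

variable {m : ℕ}

/-- The Euclidean scalar product on `ℝ^m`, restricted to the hyperplane, with a fixed vector. -/
noncomputable def dotL (y : hyperplane m) : hyperplane m →L[ℝ] ℝ :=
  (∑ j, (y : Fin m → ℝ) j • ContinuousLinearMap.proj (R := ℝ) (φ := fun _ : Fin m => ℝ) j).comp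
    (hyperplane m).subtypeL

theorem dotL_apply (y v : hyperplane m) :
    dotL y v = ∑ j, (y : Fin m → ℝ) j * (v : Fin m → ℝ) j := by
  simp [dotL]

theorem dotL_self_pos {y : hyperplane m} (hy : y ≠ 0) : 0 < dotL y y := by
  rw [dotL_apply]
  simpa [sq] using sum_sq_pos (coe_ne_zero hy)

theorem shiftMap_zero {y : hyperplane m} (hy : y ≠ 0) :
    shiftMap (y, 0) = -(√2 * Real.pi / √(dotL y y)) • y := by
  apply Subtype.ext
  rw [coe_shiftMap hy (by simp), shiftVec_zero (sum_coe y) (coe_ne_zero hy), dotL_apply]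
  simp [sq]

/-- Differentiate -√2 π y/|y| along a line: the result is a nonzero multiple of the orthogonal
projection along y. -/
theorem fderiv_shiftMap_zero {y : hyperplane m} (hy : y ≠ 0) (v : hyperplane m) :
    fderiv ℝ shiftMap (y, 0) (v, 0) = -(√2 * Real.pi / √(dotL y y)) • v
      + (√2 * Real.pi * dotL y v / √(dotL y y) ^ 3) • y := by
  have h1 : HasDerivAt (fun t : ℝ => shiftMap (y + t • v, 0)) (fderiv ℝ shiftMap (y, 0) (v, 0)) 0 := by
    have h2 : HasDerivAt (fun t : ℝ => ((y + t • v, 0) : hyperplane m × ℝ)) (v, 0) 0 := by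
      refine HasDerivAt.prodMk ?_ (hasDerivAt_const _ _)
      simpa using ((hasDerivAt_id (0 : ℝ)).smul_const v).const_add y
    have h3 : HasFDerivAt shiftMap (fderiv ℝ shiftMap (y, (0 : ℝ))) (y + (0 : ℝ) • v, (0 : ℝ)) := by
      rw [zero_smul, add_zero]
      exact (analyticAt_shiftMap hy (by simp)).differentiableAt.hasFDerivAt
    exact HasFDerivAt.comp_hasDerivAt (f := fun t : ℝ => ((y + t • v, 0) : hyperplane m × ℝ)) 0 h3 h2
  refine h1.unique ?_
  have hpos := dotL_self_pos hy
  have hs := Real.sqrt_pos.2 hpos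
  have h4 : HasDerivAt (fun t : ℝ => dotL (y + t • v) (y + t • v)) (2 * dotL y v) 0 := by
    have h5 : (fun t : ℝ => dotL (y + t • v) (y + t • v))
        = fun t => dotL y y + t * (2 * dotL y v) + t ^ 2 * dotL v v := by
      funext t
      simp only [dotL_apply, Finset.mul_sum, ← Finset.sum_add_distrib]
      refine Finset.sum_congr rfl fun j _ => ?_
      simp only [Submodule.coe_add, Submodule.coe_smul, Pi.add_apply, Pi.smul_apply, smul_eq_mul]
      ring
    rw [h5]
    have h6 := (((hasDerivAt_id (0 : ℝ)).mul_const (2 * dotL y v)).const_add (dotL y y)).add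
      ((hasDerivAt_pow 2 (0 : ℝ)).mul_const (dotL v v))
    refine h6.congr_deriv ?_
    simp
  have h0 : dotL (y + (0 : ℝ) • v) (y + (0 : ℝ) • v) = dotL y y := by simp
  have h7 : HasDerivAt (fun t : ℝ =>
      -(√2 * Real.pi / √(dotL (y + t • v) (y + t • v))) • (y + t • v))
      (-(√2 * Real.pi / √(dotL y y)) • v
      + (√2 * Real.pi * dotL y v / √(dotL y y) ^ 3) • y) 0 := by
    have h8 := h4.sqrt (by rw [h0]; exact hpos.ne')
    have h9 := ((hasDerivAt_const (0 : ℝ) (√2 * Real.pi)).div h8 (by rw [h0]; exact hs.ne')).neg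
    have h10 : HasDerivAt (fun t : ℝ => y + t • v) v 0 := by
      simpa using ((hasDerivAt_id (0 : ℝ)).smul_const v).const_add y
    refine (h9.smul h10).congr_deriv ?_
    simp only [zero_smul, add_zero, Pi.neg_apply, Pi.div_apply]
    congr 2
    field_simp
    ring
  refine h7.congr_of_eventuallyEq ?_
  have h11 : ∀ᶠ t : ℝ in 𝓝 0, y + t • v ≠ 0 := by
    have : ContinuousAt (fun t : ℝ => y + t • v) 0 := by fun_prop
    exact this.eventually_ne (by simpa using hy)
  filter_upwards [h11] with t ht
  exact shiftMap_zero ht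

theorem exists_surjective_fderiv {y : hyperplane m} {p r : ℝ}
    (h : TwoValued (y : Fin m → ℝ) p r) :
    ∃ c, 0 < c ∧ c < 1 ∧ Function.Surjective (fderiv ℝ shiftMap (y, c)) := by
  have hy : y ≠ 0 := fun hy => h.y_ne (by rw [hy]; rfl)
  have hpos := dotL_self_pos hy
  obtain ⟨j, hj⟩ := h.p_mem
  have hyj : (y : Fin m → ℝ) j ≠ 0 := hj ▸ h.p_pos.ne'
  have hsm : ∀ᶠ c : ℝ in 𝓝 0, |c| < 1 :=
    continuous_abs.continuousAt.eventually_lt_const (by simp)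
  have hcurve : ∀ c, |c| < 1 → AnalyticAt ℝ (fun c : ℝ => shiftMap (y, c)) c := fun c hc =>
    AnalyticAt.fun_comp (analyticAt_shiftMap hy hc) (analyticAt_const.prod analyticAt_id)
  let g : ℝ → ℝ := fun c => -(shiftMap (y, c) : Fin m → ℝ) j / (y : Fin m → ℝ) j
  have hg : ∀ c, |c| < 1 → shiftMap (y, c) = -g c • y ∧
      (c ≠ 0 → g c < Real.pi / √((p + r) / 2)) ∧ (c = 0 → g c = Real.pi / √((p + r) / 2)) := by
    intro c hc
    obtain ⟨g', h1, h2⟩ := h.exists_factor hc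
    have h3 : g c = g' := by
      simp only [g, coe_shiftMap hy hc, h1, Pi.smul_apply, smul_eq_mul]
      field_simp
    rw [h3]
    refine ⟨Subtype.ext ?_, h2⟩
    rw [coe_shiftMap hy hc, h1]
    rfl
  have hga : ∀ c, |c| < 1 → AnalyticAt ℝ g c := fun c hc => by
    have h1 : AnalyticAt ℝ (fun c : ℝ => (shiftMap (y, c) : Fin m → ℝ) j) c :=
      (((ContinuousLinearMap.proj (R := ℝ) (φ := fun _ : Fin m => ℝ) j).comp
        (hyperplane m).subtypeL).analyticAt _).comp (hcurve c hc)
    exact h1.neg.div_const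
  -- Otherwise the analytic function g' vanishes near 0 and g is locally constant, against g(c) <
  -- g(0).
  have hg' : ∀ᶠ c in 𝓝[≠] (0 : ℝ), deriv g c ≠ 0 := by
    refine ((hga 0 (by simp)).deriv.eventually_eq_zero_or_eventually_ne_zero).resolve_left
      fun h0 => ?_
    obtain ⟨ε, hε, hball⟩ := Metric.eventually_nhds_iff_ball.1 (h0.and hsm)
    have h1 : ∀ c ∈ Metric.ball (0 : ℝ) ε, g c = g 0 := fun c hc =>
      (convex_ball (0 : ℝ) ε).is_const_of_fderivWithin_eq_zero (𝕜 := ℝ) (f := g)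
        (fun x hx => (hga x (hball x hx).2).differentiableAt.differentiableWithinAt)
        (fun x hx => by
          rw [fderivWithin_of_isOpen Metric.isOpen_ball hx]
          ext
          simpa using (hball x hx).1) hc (Metric.mem_ball_self hε)
    have h2 : ε / 2 ∈ Metric.ball (0 : ℝ) ε := by
      rw [mem_ball_zero_iff, Real.norm_eq_abs, abs_of_pos (by positivity)]
      linarith
    have h3 := (hg _ (hball _ h2).2).2.1 (by positivity)
    have h4 := (hg 0 (by simp)).2.2 rfl
    rw [h1 _ h2, h4] at h3
    exact lt_irrefl _ h3
  -- The rank-one term fills in the missing radial direction: N is invertible at c = 0, hence for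
  -- small c.
  let N : ℝ → hyperplane m →L[ℝ] hyperplane m := fun c =>
    (fderiv ℝ shiftMap (y, c)).comp (ContinuousLinearMap.inl ℝ (hyperplane m) ℝ)
      + (dotL y).smulRight y
  have hN : ∀ c v, N c v = fderiv ℝ shiftMap (y, c) (v, 0) + dotL y v • y := fun c v => by
    simp [N]
  have hNc : ContinuousAt N 0 := by
    have h1 : ContinuousAt (fun c : ℝ => fderiv ℝ shiftMap (y, c)) 0 :=
      ContinuousAt.comp (f := fun c : ℝ => (y, c))
        (analyticAt_shiftMap hy (by simp : |(0 : ℝ)| < 1)).fderiv.continuousAt (by fun_prop)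
    exact (h1.clm_comp continuousAt_const).add continuousAt_const
  have hN0 : IsUnit (N 0) := by
    have hinj : Function.Injective (N 0) := by
      rw [injective_iff_map_eq_zero]
      intro v hv
      rw [hN, fderiv_shiftMap_zero hy] at hv
      have hs := Real.sqrt_pos.2 hpos
      have hsq : √(dotL y y) ^ 2 = dotL y y := Real.sq_sqrt hpos.le
      have h1 := congrArg (dotL y) hv
      simp only [map_add, map_smul, smul_eq_mul, map_zero] at h1
      have h2 : dotL y v * dotL y y = 0 := by
        have h3 : √2 * Real.pi * dotL y v / √(dotL y y) ^ 3 * dotL y y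
            = √2 * Real.pi / √(dotL y y) * dotL y v := by
          nth_rewrite 2 [← hsq]
          field_simp
        rw [h3] at h1
        linarith
      have h3 : dotL y v = 0 := (mul_eq_zero.1 h2).resolve_right hpos.ne'
      rw [h3] at hv
      simp only [mul_zero, zero_div, zero_smul, add_zero] at hv
      refine (smul_eq_zero.1 hv).resolve_left ?_
      have := Real.pi_pos
      have : 0 < √2 * Real.pi / √(dotL y y) := by positivity
      linarith
    have hbij : Function.Bijective (N 0) :=
      ⟨hinj, LinearMap.injective_iff_surjective (f := (N 0 : hyperplane m →ₗ[ℝ] hyperplane m)).1 hinj⟩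
    exact ContinuousLinearMap.isUnit_iff_bijective.2 hbij
  have hNu : ∀ᶠ c in 𝓝 (0 : ℝ), IsUnit (N c) := eventually_isUnit hNc hN0
  have hall : ∀ᶠ c in 𝓝[>] (0 : ℝ), 0 < c ∧ |c| < 1 ∧ deriv g c ≠ 0 ∧ IsUnit (N c) := by
    have h1 : 𝓝[>] (0 : ℝ) ≤ 𝓝[≠] 0 := nhdsWithin_mono _ fun x hx => ne_of_gt hx
    filter_upwards [self_mem_nhdsWithin, hsm.filter_mono nhdsWithin_le_nhds, hg'.filter_mono h1,
      hNu.filter_mono nhdsWithin_le_nhds] with c h1 h2 h3 h4 using ⟨h1, h2, h3, h4⟩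
  obtain ⟨c, hc0, hc1, hgc, hNc⟩ := hall.exists
  refine ⟨c, hc0, (abs_lt.1 hc1).2, fun v => ?_⟩
  obtain ⟨x, hx⟩ := (ContinuousLinearMap.isUnit_iff_bijective.1 hNc).2 v
  have h1 : fderiv ℝ shiftMap (y, c) (0, 1) = -deriv g c • y := by
    have h2 : HasDerivAt (fun c : ℝ => shiftMap (y, c)) (fderiv ℝ shiftMap (y, c) (0, 1)) c :=
      (analyticAt_shiftMap hy hc1).differentiableAt.hasFDerivAt.comp_hasDerivAt c
        ((hasDerivAt_const c y).prodMk (hasDerivAt_id c))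
    have h3 : HasDerivAt (fun c : ℝ => -g c • y) (-deriv g c • y) c :=
      (hga c hc1).differentiableAt.hasDerivAt.neg.smul_const y
    refine h2.unique (h3.congr_of_eventuallyEq ?_)
    filter_upwards [continuous_abs.continuousAt.eventually_lt_const hc1] with c' hc'
    exact (hg c' hc').1
  -- The c-derivative is -g'(c) y, so this multiple of it reproduces the rank-one term of N.
  refine ⟨(x, 0) + (-(dotL y x / deriv g c)) • (0, 1), ?_⟩
  rw [map_add, map_smul, h1, ← hx, hN, smul_smul]
  congr 2
  field_simp

end GoodPoint

/-! ### The chart (y, c) of U, the open image and the dense set -/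

section Chart

variable {a m : ℕ}

/-- The inverse of `p ↦ (recip a p, amp p)`. -/
noncomputable def unchart (a : ℕ) (z : hyperplane m × ℝ) : (Fin m → ℝ) × ℝ :=
  (fun j => sgn a j / (z.1 : Fin m → ℝ) j,
    √(∏ j, sgn a j / (z.1 : Fin m → ℝ) j) * √(1 - z.2 ^ 2))

/-- The image of `U` under `p ↦ (recip a p, amp p)`. -/
def chartSet (a m : ℕ) : Set (hyperplane m × ℝ) :=
  {z | (∀ j, 0 < sgn a j * (z.1 : Fin m → ℝ) j) ∧ 0 < z.2 ∧ z.2 < 1}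

theorem isOpen_chartSet : IsOpen (chartSet a m) := by
  have h : chartSet a m = (⋂ j, {z | 0 < sgn a j * (z.1 : Fin m → ℝ) j}) ∩
      ({z | 0 < z.2} ∩ {z | z.2 < 1}) := by
    ext z; simp [chartSet]
  rw [h]
  refine (isOpen_iInter_of_finite fun j => isOpen_lt continuous_const ?_).inter
    ((isOpen_lt continuous_const continuous_snd).inter (isOpen_lt continuous_snd continuous_const))
  exact continuous_const.mul ((continuous_apply j).comp
    (continuous_subtype_val.comp continuous_fst))

theorem convex_chartSet : Convex ℝ (chartSet a m) := by
  have h : chartSet a m = (⋂ j, {z | 0 < sgn a j * (z.1 : Fin m → ℝ) j}) ∩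
      ({z | 0 < z.2} ∩ {z | z.2 < 1}) := by
    ext z; simp [chartSet]
  rw [h]
  refine (convex_iInter fun j => convex_halfSpace_gt (f := fun z : hyperplane m × ℝ =>
    sgn a j * (z.1 : Fin m → ℝ) j) ⟨fun x y => ?_, fun c x => ?_⟩ 0).inter
    ((convex_halfSpace_gt (f := fun z : hyperplane m × ℝ => z.2) ⟨fun x y => rfl, fun c x => rfl⟩
      0).inter
    (convex_halfSpace_lt (f := fun z : hyperplane m × ℝ => z.2) ⟨fun x y => rfl, fun c x => rfl⟩ 1))
  · simp [mul_add]
  · simp; ring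

theorem ne_zero_of_mem_chartSet (hm : 0 < m) {z : hyperplane m × ℝ} (hz : z ∈ chartSet a m) :
    z.1 ≠ 0 := fun h => by
  have := hz.1 ⟨0, hm⟩
  rw [h] at this
  simp at this

theorem abs_lt_of_mem_chartSet {z : hyperplane m × ℝ} (hz : z ∈ chartSet a m) : |z.2| < 1 := by
  rw [abs_of_pos hz.2.1]; exact hz.2.2

theorem analyticAt_shiftMap_of_mem (hm : 0 < m) {z : hyperplane m × ℝ} (hz : z ∈ chartSet a m) :
    AnalyticAt ℝ (shiftMap (m := m)) z :=
  analyticAt_shiftMap (ne_zero_of_mem_chartSet hm hz) (abs_lt_of_mem_chartSet hz)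

theorem chart_mem (hm : 0 < m) {p : (Fin m → ℝ) × ℝ} (hp : p ∈ U a m) :
    (recip a p, amp p) ∈ chartSet a m := by
  have P := params_of_mem_U hm hp
  refine ⟨fun j => ?_, P.c_pos, (abs_lt.1 P.c_lt).2⟩
  rw [P.y_eq, ← mul_div_assoc, sgn_sq]
  exact one_div_pos.2 (hp.1 j)

theorem unchart_fst_pos {z : hyperplane m × ℝ} (hz : z ∈ chartSet a m) (j : Fin m) :
    0 < (unchart a z).1 j := by
  have h1 := hz.1 j
  have h2 : (unchart a z).1 j = 1 / (sgn a j * (z.1 : Fin m → ℝ) j) := by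
    have h3 := sgn_sq a j
    have h4 : sgn a j ≠ 0 := left_ne_zero_of_mul (h3.symm ▸ one_ne_zero)
    have h5 : (z.1 : Fin m → ℝ) j ≠ 0 := right_ne_zero_of_mul h1.ne'
    simp only [unchart]
    field_simp
    rw [sq, h3]
  rw [h2]
  positivity

theorem sgn_div_unchart {z : hyperplane m × ℝ} (hz : z ∈ chartSet a m) (j : Fin m) :
    sgn a j / (unchart a z).1 j = (z.1 : Fin m → ℝ) j := by
  have h4 : sgn a j ≠ 0 := left_ne_zero_of_mul ((sgn_sq a j).symm ▸ one_ne_zero)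
  have h5 : (z.1 : Fin m → ℝ) j ≠ 0 := right_ne_zero_of_mul (hz.1 j).ne'
  simp only [unchart]
  field_simp

theorem unchart_mem {z : hyperplane m × ℝ} (hz : z ∈ chartSet a m) : unchart a z ∈ U a m := by
  have hprod : 0 < ∏ j, (unchart a z).1 j := Finset.prod_pos fun j _ => unchart_fst_pos hz j
  have h1 : 0 < 1 - z.2 ^ 2 := one_sub_sq_pos (abs_lt_of_mem_chartSet hz)
  rw [mem_U_iff]
  refine ⟨unchart_fst_pos hz, ?_, mul_pos (Real.sqrt_pos.2 hprod) (Real.sqrt_pos.2 h1), ?_⟩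
  · simp only [sgn_div_unchart hz]
    exact sum_coe _
  · refine mul_lt_of_lt_one_right (Real.sqrt_pos.2 hprod) ?_
    rw [Real.sqrt_lt' one_pos]
    have := hz.2.1
    nlinarith

theorem recip_unchart {z : hyperplane m × ℝ} (hz : z ∈ chartSet a m) :
    recip a (unchart a z) = z.1 := by
  simp only [recip, sgn_div_unchart hz]
  exact proj_coe z.1

theorem amp_unchart {z : hyperplane m × ℝ} (hz : z ∈ chartSet a m) : amp (unchart a z) = z.2 := by
  have hprod : 0 < ∏ j, (unchart a z).1 j := Finset.prod_pos fun j _ => unchart_fst_pos hz j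
  have h1 : 0 < 1 - z.2 ^ 2 := one_sub_sq_pos (abs_lt_of_mem_chartSet hz)
  have h2 : (unchart a z).2 ^ 2 = (∏ j, (unchart a z).1 j) * (1 - z.2 ^ 2) := by
    change (√(∏ j, (unchart a z).1 j) * √(1 - z.2 ^ 2)) ^ 2 = _
    rw [mul_pow, Real.sq_sqrt hprod.le, Real.sq_sqrt h1.le]
  rw [amp, h2, mul_div_cancel_left₀ _ hprod.ne', sub_sub_cancel, Real.sqrt_sq hz.2.1.le]

theorem unchart_chart (hm : 0 < m) {p : (Fin m → ℝ) × ℝ} (hp : p ∈ U a m) :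
    unchart a (recip a p, amp p) = p := by
  have P := params_of_mem_U hm hp
  have h1 : ∀ j, sgn a j / (recip a p : Fin m → ℝ) j = p.1 j := fun j => by
    have h4 : sgn a j ≠ 0 := left_ne_zero_of_mul ((sgn_sq a j).symm ▸ one_ne_zero)
    have := (hp.1 j).ne'
    rw [P.y_eq]
    field_simp
  refine Prod.ext (funext h1) ?_
  simp only [unchart, h1]
  exact P.A_eq.symm

theorem differentiableAt_unchart {z : hyperplane m × ℝ} (hz : z ∈ chartSet a m) :
    DifferentiableAt ℝ (unchart a (m := m)) z := by
  have h1 : ∀ j, AnalyticAt ℝ (fun z : hyperplane m × ℝ => sgn a j / (z.1 : Fin m → ℝ) j) z :=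
    fun j => analyticAt_const.div (analyticAt_coord j) (right_ne_zero_of_mul (hz.1 j).ne')
  have hprod : 0 < ∏ j, (unchart a z).1 j := Finset.prod_pos fun j _ => unchart_fst_pos hz j
  refine AnalyticAt.differentiableAt (𝕜 := ℝ) ((AnalyticAt.pi h1).prod ((analyticAt_sqrt_comp
    (Finset.analyticAt_fun_prod _ fun j _ => h1 j) hprod.ne').mul (analyticAt_sqrt_comp
    (analyticAt_const.sub (analyticAt_snd.pow 2))
      (one_sub_sq_pos (abs_lt_of_mem_chartSet hz)).ne')))

theorem differentiableAt_balance {p : (Fin m → ℝ) × ℝ} (hp : ∀ j, 0 < p.1 j) :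
    DifferentiableAt ℝ (balance a (m := m)) p := by
  have h : balance a (m := m) = fun p => ∑ j, sgn a j / p.1 j := funext balance_eq
  rw [h]
  exact (Finset.analyticAt_fun_sum _ fun j _ =>
    analyticAt_const.div (analyticAt_coord_fst p j) (hp j).ne').differentiableAt

/-- The chart has the smooth inverse `unchart`, with values in U. Its derivative therefore lands in
the tangent space and lifts any preimage of v in chart coordinates to a tangent vector. -/
theorem derivSurjectiveAt_of_surjective (hm : 0 < m) {p : (Fin m → ℝ) × ℝ} (hp : p ∈ U a m)
    (hs : Function.Surjective (fderiv ℝ shiftMap (recip a p, amp p))) :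
    DerivSurjectiveAt a m (shift a m) p := by
  set z := (recip a p, amp p) with hz
  have hzm : z ∈ chartSet a m := chart_mem hm hp
  have hzp : unchart a z = p := unchart_chart hm hp
  let K : (Fin m → ℝ) × ℝ → hyperplane m × ℝ := fun p => (recip a p, amp p)
  have hK : HasFDerivAt K (fderiv ℝ K p) p :=
    ((analyticAt_recip hp.1).prod (analyticAt_amp hp)).differentiableAt.hasFDerivAt
  have hB : HasFDerivAt shiftMap (fderiv ℝ shiftMap z) z :=
    (analyticAt_shiftMap_of_mem hm hzm).differentiableAt.hasFDerivAt
  have hJ : HasFDerivAt (unchart a) (fderiv ℝ (unchart a) z) z :=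
    (differentiableAt_unchart hzm).hasFDerivAt
  have hnear : ∀ᶠ z' in 𝓝 z, z' ∈ chartSet a m := isOpen_chartSet.mem_nhds hzm
  refine ⟨(hyperplane m).subtypeL.comp ((fderiv ℝ shiftMap z).comp (fderiv ℝ K p)), ?_, ?_⟩
  · have h0 : HasFDerivAt shiftMap (fderiv ℝ shiftMap z) (K p) := hB
    have h1 : HasFDerivAt (fun p => (shiftMap (K p) : Fin m → ℝ)) ((hyperplane m).subtypeL.comp
        ((fderiv ℝ shiftMap z).comp (fderiv ℝ K p))) p :=
      ((hyperplane m).subtypeL.hasFDerivAt (x := shiftMap (K p))).comp p (h0.comp p hK)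
    exact h1.hasFDerivWithinAt.congr (fun q hq => shift_eq_shiftMap hm hq) (shift_eq_shiftMap hm hp)
  · refine le_antisymm ?_ fun v hv => ?_
    · rintro _ ⟨w, -, rfl⟩
      exact Subtype.prop _
    · obtain ⟨w, hw⟩ := hs ⟨v, hv⟩
      refine ⟨fderiv ℝ (unchart a) z w, ?_, ?_⟩
      · have h1 : HasFDerivAt (balance a) (fderiv ℝ (balance a) p) (unchart a z) := by
          rw [hzp]; exact (differentiableAt_balance hp.1).hasFDerivAt
        have h2 := h1.comp z hJ
        have h3 : HasFDerivAt (balance a ∘ unchart a) (0 : hyperplane m × ℝ →L[ℝ] ℝ) z := by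
          refine (hasFDerivAt_const (0 : ℝ) z).congr_of_eventuallyEq ?_
          filter_upwards [hnear] with z' hz'
          rw [Function.comp_apply, balance_eq]
          exact ((mem_U_iff _).1 (unchart_mem hz')).2.1
        have h4 := h2.unique h3
        exact congrArg (fun L : hyperplane m × ℝ →L[ℝ] ℝ => L w) h4
      · have h1 : HasFDerivAt K (fderiv ℝ K p) (unchart a z) := by rw [hzp]; exact hK
        have h2 := h1.comp z hJ
        have h3 : HasFDerivAt (K ∘ unchart a) (ContinuousLinearMap.id ℝ (hyperplane m × ℝ)) z := by
          refine (hasFDerivAt_id z).congr_of_eventuallyEq ?_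
          filter_upwards [hnear] with z' hz'
          exact Prod.ext (recip_unchart hz') (amp_unchart hz')
        have h4 := congrArg (fun L : hyperplane m × ℝ →L[ℝ] hyperplane m × ℝ => L w)
          (h2.unique h3)
        simp only [ContinuousLinearMap.comp_apply, ContinuousLinearMap.id_apply] at h4
        simp only [ContinuousLinearMap.coe_coe, ContinuousLinearMap.comp_apply, h4, hw]
        rfl

theorem shiftMap_mem_image (hm : 0 < m) {z : hyperplane m × ℝ} (hz : z ∈ chartSet a m) :
    (shiftMap z : Fin m → ℝ) ∈ shift a m '' U a m :=
  ⟨unchart a z, unchart_mem hz, by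
    rw [shift_eq_shiftMap hm (unchart_mem hz), recip_unchart hz, amp_unchart hz]⟩

theorem exists_good_point (ha : 1 ≤ a) (ham : a < m) (hm : 3 ≤ m) :
    ∃ z ∈ chartSet a m, Function.Surjective (fderiv ℝ (shiftMap (m := m)) z) := by
  have h := twoValued_refVec ha ham hm
  obtain ⟨c, hc0, hc1, hs⟩ :=
    exists_surjective_fderiv (y := (⟨refVec a m, h.sum_y⟩ : hyperplane m)) h
  refine ⟨_, ⟨fun j => ?_, hc0, hc1⟩, hs⟩
  have h1 := h.p_pos
  have h2 := h.r_pos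
  simp only [refVec, sgn]
  split_ifs <;> linarith

theorem image_mem_nhds (hm : 0 < m) {z : hyperplane m × ℝ} (hz : z ∈ chartSet a m)
    (hs : Function.Surjective (fderiv ℝ shiftMap z)) :
    shiftMap '' chartSet a m ∈ 𝓝 (shiftMap z) := by
  have h1 : HasStrictFDerivAt shiftMap (fderiv ℝ shiftMap z) z :=
    (analyticAt_shiftMap_of_mem hm hz).hasStrictFDerivAt
  rw [← h1.map_nhds_eq_of_surj (LinearMap.range_eq_top.2 hs)]
  exact image_mem_map (isOpen_chartSet.mem_nhds hz)

theorem exists_open_subset_image (ha : 1 ≤ a) (ham : a < m) (hm : 3 ≤ m) :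
    ∃ O : Set (Fin m → ℝ), IsOpen O ∧ (O ∩ (hyperplane m : Set (Fin m → ℝ))).Nonempty ∧
      O ∩ (hyperplane m : Set (Fin m → ℝ)) ⊆ shift a m '' U a m := by
  obtain ⟨z, hz, hs⟩ := exists_good_point ha ham hm
  have h1 := image_mem_nhds (by omega) hz hs
  obtain ⟨O, hO, hOW⟩ := isOpen_induced_iff.1 (isOpen_interior (s := shiftMap '' chartSet a m))
  refine ⟨O, hO, ⟨shiftMap z, ?_, (shiftMap z).2⟩, ?_⟩
  · have : shiftMap z ∈ Subtype.val ⁻¹' O := hOW ▸ mem_interior_iff_mem_nhds.2 h1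
    exact this
  · rintro v ⟨hvO, hvH⟩
    have h2 : (⟨v, hvH⟩ : hyperplane m) ∈ interior (shiftMap '' chartSet a m) := hOW ▸ hvO
    obtain ⟨z', hz', hzv⟩ := interior_subset h2
    have := shiftMap_mem_image (by omega) hz'
    rwa [hzv] at this

theorem finrank_hyperplane (hm : 0 < m) : Module.finrank ℝ (hyperplane m) = m - 1 := by
  let f : (Fin m → ℝ) →ₗ[ℝ] ℝ := ∑ j, LinearMap.proj j
  have hf : ∀ x, f x = ∑ j, x j := fun x => by simp [f]
  have hker : hyperplane m = LinearMap.ker f := by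
    ext x
    rw [LinearMap.mem_ker, hf]
    rfl
  have hsurj : LinearMap.range f = ⊤ := by
    refine LinearMap.range_eq_top.2 fun t => ⟨Pi.single ⟨0, hm⟩ t, ?_⟩
    rw [hf]; simp
  have h := LinearMap.finrank_range_add_finrank_ker f
  rw [hsurj, finrank_top, Module.finrank_self, Module.finrank_fin_fun] at h
  rw [hker]
  omega

/-- The image lies in the hyperplane and contains an open piece of it; the hyperplane sits
isometrically in ℝ^m. -/
theorem dimH_image_shift (ha : 1 ≤ a) (ham : a < m) (hm : 3 ≤ m) :
    dimH (shift a m '' U a m) = ((m - 1 : ℕ) : ENNReal) := by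
  have hm0 : 0 < m := by omega
  obtain ⟨z, hz, hs⟩ := exists_good_point ha ham hm
  rw [← finrank_hyperplane hm0]
  have hiso : Isometry ((↑) : hyperplane m → Fin m → ℝ) := isometry_subtype_coe
  refine le_antisymm ?_ ?_
  · rw [← Real.dimH_univ_eq_finrank, ← hiso.dimH_image]
    refine dimH_mono ?_
    rintro _ ⟨p, hp, rfl⟩
    exact ⟨_, mem_univ _, (shift_eq_shiftMap hm0 hp).symm⟩
  · rw [← Real.dimH_of_mem_nhds (image_mem_nhds hm0 hz hs), ← hiso.dimH_image]
    refine dimH_mono ?_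
    rintro _ ⟨_, ⟨z', hz', rfl⟩, rfl⟩
    exact shiftMap_mem_image hm0 hz'

theorem exists_dense_open (ha : 1 ≤ a) (ham : a < m) (hm : 3 ≤ m) :
    ∃ O : Set ((Fin m → ℝ) × ℝ), IsOpen O ∧ U a m ⊆ closure (U a m ∩ O) ∧
      ∀ p ∈ U a m ∩ O, DerivSurjectiveAt a m (shift a m) p := by
  have hm0 : 0 < m := by omega
  obtain ⟨z₁, hz₁, hs⟩ := exists_good_point ha ham hm
  obtain ⟨σ, hσ⟩ := LinearMap.exists_rightInverse_of_surjective
    (fderiv ℝ (shiftMap (m := m)) z₁ : hyperplane m × ℝ →ₗ[ℝ] hyperplane m)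
    (LinearMap.range_eq_top.2 hs)
  let σ' : hyperplane m →L[ℝ] hyperplane m × ℝ := LinearMap.toContinuousLinearMap σ
  -- With σ a right inverse of the derivative at the good point z₁, Δ is analytic, Δ z₁ = 1, and Δ z
  -- ≠ 0 forces surjectivity at z.
  let Δ : hyperplane m × ℝ → ℝ := fun z =>
    LinearMap.det (((fderiv ℝ shiftMap z).comp σ' : hyperplane m →L[ℝ] hyperplane m) :
      hyperplane m →ₗ[ℝ] hyperplane m)
  have hΔ1 : Δ z₁ = 1 := by
    have : (((fderiv ℝ shiftMap z₁).comp σ' : hyperplane m →L[ℝ] hyperplane m) :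
      hyperplane m →ₗ[ℝ] hyperplane m) = LinearMap.id := hσ
    simp only [Δ, this, LinearMap.det_id]
  have hΔs : ∀ z, Δ z ≠ 0 → Function.Surjective (fderiv ℝ (shiftMap (m := m)) z) := fun z hz v => by
    have h1 : Function.Surjective (((fderiv ℝ shiftMap z).comp σ' :
        hyperplane m →L[ℝ] hyperplane m) : hyperplane m →ₗ[ℝ] hyperplane m) :=
      ((Module.End.isUnit_iff _).1 ((LinearMap.isUnit_iff_isUnit_det _).2 hz.isUnit)).2
    obtain ⟨x, hx⟩ := h1 v
    exact ⟨σ' x, hx⟩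
  have hΔa : ∀ z ∈ chartSet a m, AnalyticAt ℝ Δ z := fun z hz => by
    refine analyticAt_det ?_
    exact analyticAt_comp_const (analyticAt_shiftMap_of_mem hm0 hz).fderiv σ'
  let W : Set ((Fin m → ℝ) × ℝ) := {p | Δ (recip a p, amp p) ≠ 0}
  have hW : ∀ p ∈ U a m, p ∈ W → p ∈ interior W := fun p hp hpW => by
    rw [mem_interior_iff_mem_nhds]
    have h1 : ContinuousAt (fun p => Δ (recip a p, amp p)) p :=
      ContinuousAt.comp (f := fun p : (Fin m → ℝ) × ℝ => (recip a p, amp p))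
        (hΔa _ (chart_mem hm0 hp)).continuousAt
        ((analyticAt_recip hp.1).continuousAt.prodMk (analyticAt_amp hp).continuousAt)
    exact h1.eventually_ne hpW
  refine ⟨interior W, isOpen_interior, fun p hp => ?_, fun p hp => ?_⟩
  · set z := (recip a p, amp p) with hz
    have hzm : z ∈ chartSet a m := chart_mem hm0 hp
    -- The chart domain is convex, so the segment from z to z₁ stays inside. Along it Δ is analytic
    -- in one variable and nonzero at t = 1, hence nonzero for some arbitrarily small t > 0.
    let ℓ : ℝ → hyperplane m × ℝ := fun t => z + t • (z₁ - z)
    have hℓ : ∀ t ∈ Icc (0 : ℝ) 1, ℓ t ∈ chartSet a m := fun t ht =>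
      convex_chartSet.add_smul_sub_mem hzm hz₁ ht
    have hℓ0 : ℓ 0 = z := by simp [ℓ]
    have hfa : AnalyticOnNhd ℝ (fun t => Δ (ℓ t)) (Icc 0 1) := fun t ht => by
      refine AnalyticAt.fun_comp (hΔa _ (hℓ t ht)) ?_
      exact analyticAt_const.add (analyticAt_id.smul analyticAt_const)
    have hfreq : ∃ᶠ t in 𝓝[>] (0 : ℝ), Δ (ℓ t) ≠ 0 := by
      intro hev
      have h1 : ∃ᶠ t in 𝓝[≠] (0 : ℝ), Δ (ℓ t) = 0 := by
        have h2 : ∀ᶠ t in 𝓝[>] (0 : ℝ), Δ (ℓ t) = 0 := hev.mono fun t ht => not_not.1 ht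
        exact h2.frequently.filter_mono (nhdsWithin_mono _ fun x hx => ne_of_gt hx)
      have h3 := hfa.eqOn_zero_of_preconnected_of_frequently_eq_zero isPreconnected_Icc
        (left_mem_Icc.2 zero_le_one) h1 (right_mem_Icc.2 zero_le_one)
      simp [ℓ, hΔ1] at h3
    have hcont : Tendsto (fun t => unchart a (ℓ t)) (𝓝[>] 0) (𝓝 p) := by
      have h1 : ContinuousAt (fun t => unchart a (ℓ t)) 0 := by
        refine ContinuousAt.comp (g := unchart a) ?_ (by fun_prop)
        exact (differentiableAt_unchart (hℓ 0 (left_mem_Icc.2 zero_le_one))).continuousAt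
      have h2 := h1.tendsto
      rw [hℓ0, unchart_chart hm0 hp] at h2
      exact h2.mono_left nhdsWithin_le_nhds
    refine mem_closure_of_frequently_of_tendsto ?_ hcont
    have hIoc : ∀ᶠ t in 𝓝[>] (0 : ℝ), t ∈ Ioo (0 : ℝ) 1 := Ioo_mem_nhdsGT one_pos
    refine (hfreq.and_eventually hIoc).mono fun t ht => ?_
    have hmem := hℓ t (Ioo_subset_Icc_self ht.2)
    refine ⟨unchart_mem hmem, hW _ (unchart_mem hmem) ?_⟩
    change Δ _ ≠ 0
    rw [recip_unchart hmem, amp_unchart hmem]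
    exact ht.1
  · exact derivSurjectiveAt_of_surjective hm0 hp.1 (hΔs _ (interior_subset hp.2))

end Chart

end PeriodShift

theorem proposition5p7 (m a : ℕ) (ha : 1 ≤ a) (ham : a < m) :
    (∀ p ∈ PeriodShift.U a m, PeriodShift.IsShift a p (PeriodShift.shift a m p)) ∧
    Set.MapsTo (PeriodShift.shift a m) (PeriodShift.U a m) (PeriodShift.V a m) ∧
    AnalyticOn ℝ (PeriodShift.shift a m) (PeriodShift.U a m) ∧
    (m = 2 → ∀ p ∈ PeriodShift.U a m, ∀ j : Fin m,
      PeriodShift.shift a m p j = if (j : ℕ) < a then -Real.pi else Real.pi) ∧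
    (3 ≤ m →
      (∃ O : Set (Fin m → ℝ), IsOpen O ∧
        (O ∩ (PeriodShift.hyperplane m : Set (Fin m → ℝ))).Nonempty ∧
        O ∩ (PeriodShift.hyperplane m : Set (Fin m → ℝ)) ⊆
          PeriodShift.shift a m '' PeriodShift.U a m) ∧
      dimH (PeriodShift.shift a m '' PeriodShift.U a m) = ((m - 1 : ℕ) : ENNReal) ∧
      ∃ O : Set ((Fin m → ℝ) × ℝ), IsOpen O ∧
        PeriodShift.U a m ⊆ closure (PeriodShift.U a m ∩ O) ∧
        ∀ p ∈ PeriodShift.U a m ∩ O, PeriodShift.DerivSurjectiveAt a m (PeriodShift.shift a m) p) := by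
  have hm : 0 < m := by omega
  refine ⟨fun p hp => PeriodShift.isShift_shift hm hp, PeriodShift.mapsTo_shift hm,
    PeriodShift.analyticOn_shift hm, ?_, fun h3 =>
    ⟨PeriodShift.exists_open_subset_image ha ham h3, PeriodShift.dimH_image_shift ha ham h3,
      PeriodShift.exists_dense_open ha ham h3⟩⟩
  rintro rfl p hp j
  obtain rfl : a = 1 := by omega
  exact PeriodShift.shift_two hp j
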